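/- **Setting.** Fix a countably infinite supply of unary predicate symbols $P_1,P_2,\dots$ and constants $a_1,a_2,\dots$. A language $\mathcal L$ is a finite set of these predicates together with all the constants (no equality, no other symbols); $L_q$ has predicates $P_1,\dots,P_q$; $S\mathcal L$ is its set of first-order sentences. A probability function on $\mathcal L$ is $w:S\mathcal L\to[0,1]$ such that (P1) $w(\theta)=1$ if $\models\theta$; (P2) $w(\theta\vee\phi)=w(\theta)+w(\phi)$ if $\theta\models\neg\phi$; (P3) $w(\exists x\,\psi(x))=\lim_{n\to\infty}w(\bigvee_{j=1}^n\psi(a_j))$. It satisfies Ex (respectively Px) if it is invariant under all permutations of the constants (respectively of the predicates of $\mathcal L$). A probability function $w$ on $L$ satisfies Unary Language Invariance (ULi) if there are probability functions $w^{\mathcal L}$, one for each finite language $\mathcal L$, all satisfying Ex and Px, with $w^{L}=w$ and $w^{\mathcal L'}=w^{\mathcal L}\upharpoonright S\mathcal L'$ whenever $\mathcal L'\subseteq\mathcal L$. An atom of $L_q$ is a formula $\alpha(x)=\bigwedge_{i=1}^q P_i^{\epsilon_i}(x)$ with $\epsilon_i\in\{0,1\}$, where $P_i^1=P_i$, $P_i^0=\neg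 P_i$; let $\alpha_1,\dots,\alpha_{2^q}$ be the atoms. A state description is $\Theta=\bigwedge_{j=1}^n\alpha_{h_j}(a_{i_j})$ with distinct constants $a_{i_1},\dots,a_{i_n}$; for $\vec c=\langle c_1,\dots,c_{2^q}\rangle$ put $w_{\vec c}(\Theta)=\prod_{i=1}^{2^q} c_i^{n_i}$, $n_i=|\{j: h_j=i\}|$. Work in an ultrapower of the standard universe by an ultrafilter $U$ on a set $I$, and let $\nu\in{}^*\mathbb N\setminus\mathbb N$ be an infinite hypernatural number. Let $\Upsilon$ range over the state descriptions of $L_\nu$ for $a_1,\dots,a_\nu$, i.e. over the internal $\nu\times\nu$ matrices $(\epsilon_{i,j})$ with entries in $\{0,1\}$ (rows are predicates, columns are constants). For internal $e:\{1,\dots,q\}\to\{1,\dots,\nu\}$ let $w^\Upsilon_{\langle e(1),\dots,e(q)\rangle}=w_{\vec c}$, where $c_i$ is the number of columns of the $q\times\nu$ matrix formed by the rows $e(1),\dots,e(q)$ of $\Upsilon$ that equal the sign vector of $\alpha_i$, divided by $\nu$. For state descriptions $\Theta$ of $L_q$ put $$\nabla^{L_q}_\Upsilon(\Theta)=\sum_{e:\{1,\dots,q\}\to\{1,\dots,\nu\}}\frac1{\nu^q}\,w^\Upsilon_{\langle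 e(1),\dots,e(q)\rangle}(\Theta).$$ **Theorem 4.2 (Representation Theorem for ULi).** Let $L=L_q$. For every $\Upsilon$ there is exactly one probability function ${}^\circ\nabla^L_\Upsilon$ on $SL$ whose value at each state description $\Theta$ is the standard part of $\nabla^L_\Upsilon(\Theta)$. A probability function $w$ on $L$ satisfies ULi if and only if there is a $\sigma$-additive probability measure $\rho$ on the $\sigma$-algebra generated by the internal sets of $\nu\times\nu$ state descriptions $\Upsilon$ such that $$w(\theta)=\int{}^\circ\nabla^L_\Upsilon(\theta)\,d\rho(\Upsilon)\qquad\text{for all }\theta\in SL$$ (the integrands being $\rho$-integrable). -/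

import Mathlib

open Filter Topology MeasureTheory

noncomputable section

namespace UnaryIL

/-- First order formulas without equality over a purely unary language with set of predicate
symbols `P` and constant symbols `a_0, a_1, a_2, …`, whose free variables are among
`x_0, …, x_{n-1}`.  A term is a constant `Sum.inl j` or a variable `Sum.inr i`.  The quantifier
`ex` binds the last variable `x_n` of a formula in `n + 1` variables.  The remaining connectives
and the universal quantifier are the usual abbreviations. -/
inductive Fml (P : Type) : ℕ → Type
  | top {n : ℕ} : Fml P n
  | rel {n : ℕ} (p : P) (t : ℕ ⊕ Fin n) : Fml P n
  | neg {n : ℕ} (φ : Fml P n) : Fml P n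
  | and {n : ℕ} (φ ψ : Fml P n) : Fml P n
  | or {n : ℕ} (φ ψ : Fml P n) : Fml P n
  | ex {n : ℕ} (φ : Fml P (n + 1)) : Fml P n

/-- Sentences are formulas without free variables. -/
abbrev Sentence (P : Type) : Type := Fml P 0

/-- Under a quantifier, a substitution leaves the newly bound variable alone. -/
def liftSubst {n m : ℕ} (s : Fin n → ℕ ⊕ Fin m) : Fin (n + 1) → ℕ ⊕ Fin (m + 1) :=
  Fin.snoc (α := fun _ => ℕ ⊕ Fin (m + 1)) (fun i => Sum.map id Fin.castSucc (s i))
    (Sum.inr (Fin.last m))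

namespace Fml

/-- Simultaneous substitution of terms for the free variables. -/
def subst {P : Type} : {n : ℕ} → Fml P n → {m : ℕ} → (Fin n → ℕ ⊕ Fin m) → Fml P m
  | _, top, _, _ => top
  | _, rel p t, _, s => rel p (Sum.elim Sum.inl s t)
  | _, neg φ, _, s => neg (φ.subst s)
  | _, and φ ψ, _, s => and (φ.subst s) (ψ.subst s)
  | _, or φ ψ, _, s => or (φ.subst s) (ψ.subst s)
  | _, ex φ, _, s => ex (φ.subst (liftSubst s))

/-- `ψ(a_c)` for a formula `ψ(x)` with one free variable. -/
def inst {P : Type} (ψ : Fml P 1) (c : ℕ) : Sentence P := ψ.subst (fun _ => Sum.inl c)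

/-- Replace every predicate symbol `p` by `f p` and every constant `a_j` by `a_{g j}`. -/
def rename {P P' : Type} (f : P → P') (g : ℕ → ℕ) : {n : ℕ} → Fml P n → Fml P' n
  | _, top => top
  | _, rel p t => rel (f p) (Sum.map g id t)
  | _, neg φ => neg (φ.rename f g)
  | _, and φ ψ => and (φ.rename f g) (ψ.rename f g)
  | _, or φ ψ => or (φ.rename f g) (ψ.rename f g)
  | _, ex φ => ex (φ.rename f g)

/-- The disjunction `φ_0 ∨ ⋯ ∨ φ_n`. -/
def disj {P : Type} (φ : ℕ → Sentence P) : ℕ → Sentence P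
  | 0 => φ 0
  | n + 1 => or (disj φ n) (φ (n + 1))

/-- Finite conjunctions. -/
def conj {P : Type} (l : List (Sentence P)) : Sentence P := l.foldr and top

end Fml

/-- Structures for the language (nonempty because of the constants). -/
structure Model (P : Type) where
  Dom : Type
  pred : P → Dom → Prop
  const : ℕ → Dom

/-- Tarski satisfaction of a formula in a structure under an assignment of the variables. -/
def Model.Sat {P : Type} (M : Model P) : {n : ℕ} → Fml P n → (Fin n → M.Dom) → Prop
  | _, .top, _ => True
  | _, .rel p t, v => M.pred p (Sum.elim M.const v t)
  | _, .neg φ, v => ¬ M.Sat φ v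
  | _, .and φ ψ, v => M.Sat φ v ∧ M.Sat ψ v
  | _, .or φ ψ, v => M.Sat φ v ∨ M.Sat ψ v
  | _, .ex φ, v => ∃ d : M.Dom, M.Sat φ (Fin.snoc (α := fun _ => M.Dom) v d)

/-- Truth of a sentence in a structure. -/
def Model.True {P : Type} (M : Model P) (θ : Sentence P) : Prop := M.Sat θ Fin.elim0

/-- `⊨ θ`. -/
def Valid {P : Type} (θ : Sentence P) : Prop := ∀ M : Model P, M.True θ

/-- `θ ⊨ φ`. -/
def Entails {P : Type} (θ φ : Sentence P) : Prop := ∀ M : Model P, M.True θ → M.True φ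

/-- Probability functions on the sentences of a unary language: conditions (P1), (P2), (P3). -/
structure IsProbFun {P : Type} (w : Sentence P → ℝ) : Prop where
  mem_Icc : ∀ θ, w θ ∈ Set.Icc (0 : ℝ) 1
  valid : ∀ θ, Valid θ → w θ = 1
  add : ∀ θ φ, Entails θ φ.neg → w (θ.or φ) = w θ + w φ
  exists_lim : ∀ ψ : Fml P 1,
    Tendsto (fun n => w (Fml.disj (fun j => ψ.inst j) n)) atTop (𝓝 (w ψ.ex))

/-- Constant Exchangeability. -/
def Ex {P : Type} (w : Sentence P → ℝ) : Prop :=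
  ∀ (σ : Equiv.Perm ℕ) (φ : Sentence P), w (φ.rename id σ) = w φ

/-- Predicate Exchangeability. -/
def Px {P : Type} (w : Sentence P → ℝ) : Prop :=
  ∀ (σ : Equiv.Perm P) (φ : Sentence P), w (φ.rename σ id) = w φ

/-- The finite unary languages are the finite sets of predicate symbols from a countably infinite
supply `P_0, P_1, P_2, …`; this is the language `L_q` with the first `q` predicate symbols. -/
abbrev Lang (q : ℕ) : Finset ℕ := Finset.range q

/-- Unary Language Invariance of a function `w` on the sentences of the language `L`. -/
def ULi (L : Finset ℕ) (w : Sentence L → ℝ) : Prop :=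
  ∃ W : (K : Finset ℕ) → Sentence K → ℝ,
    (∀ K, IsProbFun (W K) ∧ Ex (W K) ∧ Px (W K)) ∧
    W L = w ∧
    ∀ (K' K : Finset ℕ) (h : K' ⊆ K) (θ : Sentence K'),
      W K' θ = W K (θ.rename (Set.inclusion h) id)

/-- `α(a_c)` for the atom `α(x) = ⋀ P^{ε}(x)` given by the signs `ε`
(`true` for the predicate, `false` for its negation). -/
def atomAt {P : Type} [Fintype P] (ε : P → Bool) (c : ℕ) : Sentence P :=
  Fml.conj (Finset.univ.toList.map fun p =>
    if ε p then Fml.rel p (Sum.inl c) else (Fml.rel p (Sum.inl c)).neg)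

/-- The state description `α_{h_1}(a_{i_1}) ∧ ⋯ ∧ α_{h_n}(a_{i_n})`; atoms are identified with
their sign vectors. -/
def stateDesc {P : Type} [Fintype P] {n : ℕ} (h : Fin n → P → Bool) (i : Fin n → ℕ) :
    Sentence P :=
  Fml.conj (List.ofFn fun j => atomAt (h j) (i j))

/-- The value `w_x(Θ) = ∏_α x_α ^ n_α`, where `n_α = |{j | h_j = α}|`, of the product function
`w_x` at a state description `Θ = ⋀_j α_{h_j}(a_{i_j})`. -/
def productFun {P : Type} [Fintype P] [DecidableEq P] (x : (P → Bool) → ℝ) {n : ℕ}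
    (h : Fin n → P → Bool) : ℝ :=
  ∏ α : P → Bool, x α ^ (Finset.univ.filter fun j => h j = α).card

/-- The frequencies `c_α` of the atoms among the columns of the matrix whose row for the predicate
`p` is row `e p` of the `m × m` matrix `M`.  Rows of `M` correspond to predicates and columns to
constants. -/
def colFreq {P : Type} [Fintype P] {m : ℕ} (M : Fin m → Fin m → Bool) (e : P → Fin m)
    (α : P → Bool) : ℝ :=
  ((Finset.univ.filter fun j : Fin m => ∀ p, M (e p) j = α p).card : ℝ) / (m : ℝ)

/-- The average over all choices `e` of rows (with replacement) of the induced product functions,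
for a matrix of finite size `m × m`. -/
def nablaFin {P : Type} [Fintype P] [DecidableEq P] {m : ℕ} (M : Fin m → Fin m → Bool)
    {n : ℕ} (h : Fin n → P → Bool) : ℝ :=
  ∑ e : P → Fin m, 1 / (m : ℝ) ^ Fintype.card P * productFun (colFreq M e) h

/-- State descriptions `Υ(P_1, …, P_ν, a_1, …, a_ν)` of `L_ν` in the ultrapower by `U`, where `ν`
is the hypernatural number represented by the sequence `N`: the internal `ν × ν` matrices with
entries in `{0, 1}`. -/
def HyperStateDesc {I : Type*} (U : Ultrafilter I) (N : I → ℕ) : Type _ :=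
  (U : Filter I).Product fun k => Fin (N k) → Fin (N k) → Bool

/-- The internal set of `ν × ν` matrices represented by the sets `S k` of `N k × N k` matrices. -/
def internalSet {I : Type*} (U : Ultrafilter I) (N : I → ℕ)
    (S : (k : I) → Set (Fin (N k) → Fin (N k) → Bool)) : Set (HyperStateDesc U N) :=
  {Y | ∃ f : (k : I) → Fin (N k) → Fin (N k) → Bool,
    Quotient.mk (productSetoid (U : Filter I) _) f = Y ∧ ∀ᶠ k in (U : Filter I), f k ∈ S k}

/-- The `σ`-algebra generated by the internal sets. -/
instance {I : Type*} (U : Ultrafilter I) (N : I → ℕ) : MeasurableSpace (HyperStateDesc U N) :=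
  MeasurableSpace.generateFrom {A | ∃ S, A = internalSet U N S}

/-- The hyperreal value `∇_Υ(Θ)` at the state description `Θ` with atoms `h`: the internal
extension of `nablaFin`. -/
def nabla {I : Type*} (U : Ultrafilter I) (N : I → ℕ) {P : Type} [Fintype P] [DecidableEq P]
    (Y : HyperStateDesc U N) {n : ℕ} (h : Fin n → P → Bool) : Germ (U : Filter I) ℝ :=
  Quotient.lift
    (fun f : (k : I) → Fin (N k) → Fin (N k) → Bool =>
      ((fun k => nablaFin (f k) h : I → ℝ) : Germ (U : Filter I) ℝ))
    (fun _ _ hfg => Germ.coe_eq.2 (Eventually.mono hfg fun _ hk =>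
      congrArg (fun M => nablaFin M h) hk)) Y

/-- `v` is a probability function on all sentences of the language that extends `°∇_Υ`, i.e. its
value at every state description (for distinct constants) is the standard part of the value of
`∇_Υ`. -/
def ExtendsStNabla {I : Type*} (U : Ultrafilter I) (N : I → ℕ) {P : Type} [Fintype P]
    [DecidableEq P] (Y : HyperStateDesc U N) (v : Sentence P → ℝ) : Prop :=
  IsProbFun v ∧ ∀ (n : ℕ) (h : Fin n → P → Bool) (i : Fin n → ℕ), Function.Injective i →
    v (stateDesc h i) = ArchimedeanClass.stdPart (nabla U N Y h)

/-- The function `°∇_Υ` on all sentences: the probability function extending `°∇_Υ`. -/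
def stNabla {I : Type*} (U : Ultrafilter I) (N : I → ℕ) {P : Type} [Fintype P]
    [DecidableEq P] (Y : HyperStateDesc U N) : Sentence P → ℝ :=
  Classical.epsilon (ExtendsStNabla U N Y)

end UnaryIL

end

/-! For a finite matrix M, the value ∇_M(Θ) is the probability that Θ holds in the array M(e p)(c
j), where the rows e p and the columns c j are drawn independently and uniformly, with replacement
(`sampleMeasure_pattern`). So M gives a law on the compact space of infinite 0-1 arrays. For a
hyperfinite Υ, the laws of its representatives converge along U. The events fixing finitely many
entries are clopen, so the limit law gives each of them the standard part of ∇_Υ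
(`tendsto_sampleMeasure`, `stdPart_nabla`). Truth of a sentence in the structure read off an array
is a measurable event, and the limit law thus defines a probability function °∇_Υ. It is unique
because (P3) lets every sentence be approximated by sentences about finitely many constants
(`IsProbFun.ext_stateDesc`).

Mixtures satisfy ULi because the limit law looks the same through any injective choice of rows and
columns. Hence each °∇_Υ is exchangeable in constants and predicates and compatible between
languages, and integration preserves this.

Conversely, a language invariant family gives for every m a random m × m matrix in which distinct
rows and columns show Θ with probability w(Θ). Taking m = N k, these laws form an internal
probability, which saturation extends to a σ-additive ρ (`exists_loebMeasure`). Expectations of ∇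
converge to the integral of its standard part (`tendsto_integral_loebMeasure`). They also converge
to w(Θ), since the only error is the probability of drawing a row or column twice, which vanishes as
N tends to infinity (`abs_integral_nablaFin_sub_le`, `tendsto_injRatio`). -/

namespace UnaryIL

/-! ### Semantics of renaming, substitution and state descriptions -/

variable {P P' : Type}

/-- The interpretation of a renamed language in a structure. -/
def Model.reindex (M : Model P') (f : P → P') (g : ℕ → ℕ) : Model P where
  Dom := M.Dom
  pred p := M.pred (f p)
  const j := M.const (g j)

theorem sat_rename (M : Model P') (f : P → P') (g : ℕ → ℕ) {n : ℕ} (φ : Fml P n)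
    (v : Fin n → M.Dom) : M.Sat (φ.rename f g) v ↔ (M.reindex f g).Sat φ v := by
  induction φ with
  | top => rfl
  | rel p t => cases t <;> rfl
  | neg φ ih => exact not_congr (ih v)
  | and φ ψ ih ih' => exact and_congr (ih v) (ih' v)
  | or φ ψ ih ih' => exact or_congr (ih v) (ih' v)
  | ex φ ih => exact exists_congr fun d => ih (Fin.snoc (α := fun _ => M.Dom) v d)

theorem true_rename (M : Model P') (f : P → P') (g : ℕ → ℕ) (φ : Sentence P) :
    M.True (φ.rename f g) ↔ (M.reindex f g).True φ := sat_rename M f g φ _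

theorem sat_subst (M : Model P) {n : ℕ} (φ : Fml P n) {m : ℕ} (s : Fin n → ℕ ⊕ Fin m)
    (v : Fin m → M.Dom) :
    M.Sat (φ.subst s) v ↔ M.Sat φ (fun i => Sum.elim M.const v (s i)) := by
  induction φ generalizing m with
  | top => rfl
  | rel p t => cases t <;> rfl
  | neg φ ih => exact not_congr (ih s v)
  | and φ ψ ih ih' => exact and_congr (ih s v) (ih' s v)
  | or φ ψ ih ih' => exact or_congr (ih s v) (ih' s v)
  | ex φ ih =>
    refine exists_congr fun d => (ih (liftSubst s) _).trans (iff_of_eq (congrArg _ ?_))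
    funext i
    refine Fin.lastCases ?_ (fun i => ?_) i
    · simp [liftSubst]
    · simp only [liftSubst, Fin.snoc_castSucc]
      cases s i <;> simp

/-- Without equality in the language, H need not be injective; surjectivity supplies preimages of
witnesses. This later turns a permutation of the constants into one of the domain. -/
theorem sat_of_surjective (M M' : Model P) (H : M.Dom → M'.Dom) (hs : Function.Surjective H)
    (hc : ∀ j, H (M.const j) = M'.const j) (hp : ∀ p d, M.pred p d ↔ M'.pred p (H d))
    {n : ℕ} (φ : Fml P n) (v : Fin n → M.Dom) :
    M.Sat φ v ↔ M'.Sat φ (fun i => H (v i)) := by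
  induction φ with
  | top => rfl
  | rel p t =>
    cases t with
    | inl j => exact (hp _ _).trans (iff_of_eq (congrArg _ (hc j)))
    | inr i => exact hp _ _
  | neg φ ih => exact not_congr (ih v)
  | and φ ψ ih ih' => exact and_congr (ih v) (ih' v)
  | or φ ψ ih ih' => exact or_congr (ih v) (ih' v)
  | ex φ ih =>
    have key (d : M.Dom) : M.Sat φ (Fin.snoc (α := fun _ => M.Dom) v d) ↔
        M'.Sat φ (Fin.snoc (α := fun _ => M'.Dom) (fun i => H (v i)) (H d)) := by
      refine (ih _).trans (iff_of_eq (congrArg _ ?_))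
      funext i
      refine Fin.lastCases ?_ (fun i => ?_) i <;> simp
    constructor
    · rintro ⟨d, hd⟩
      exact ⟨H d, (key d).1 hd⟩
    · rintro ⟨d', hd⟩
      obtain ⟨d, rfl⟩ := hs d'
      exact ⟨d, (key d).2 hd⟩

theorem true_disj (M : Model P) (φ : ℕ → Sentence P) (n : ℕ) :
    M.True (Fml.disj φ n) ↔ ∃ j ≤ n, M.True (φ j) := by
  induction n with
  | zero => simp [Fml.disj]
  | succ n ih =>
    refine (or_congr_left ih).trans ⟨?_, ?_⟩
    · rintro (⟨j, hj, h⟩ | h)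
      · exact ⟨j, by omega, h⟩
      · exact ⟨n + 1, le_rfl, h⟩
    · rintro ⟨j, hj, h⟩
      rcases Nat.le_succ_iff.1 hj with hj | rfl
      · exact Or.inl ⟨j, hj, h⟩
      · exact Or.inr h

theorem true_conj (M : Model P) (l : List (Sentence P)) :
    M.True (Fml.conj l) ↔ ∀ φ ∈ l, M.True φ := by
  induction l with
  | nil => exact iff_of_true trivial (by simp)
  | cons φ l ih =>
    rw [List.forall_mem_cons, ← ih]
    rfl

theorem true_atomAt [Fintype P] (M : Model P) (ε : P → Bool) (c : ℕ) :
    M.True (atomAt ε c) ↔ ∀ p, (M.pred p (M.const c) ↔ ε p = true) := by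
  simp only [atomAt, true_conj, List.mem_map, Finset.mem_toList, Finset.mem_univ, true_and,
    forall_exists_index, forall_apply_eq_imp_iff]
  refine forall_congr' fun p => ?_
  cases h : ε p
  · simp [Model.True, Model.Sat]
  · simp [Model.True, Model.Sat]

theorem true_stateDesc [Fintype P] (M : Model P) {n : ℕ} (h : Fin n → P → Bool) (i : Fin n → ℕ) :
    M.True (stateDesc h i) ↔ ∀ j p, (M.pred p (M.const (i j)) ↔ h j p = true) := by
  simp only [stateDesc, true_conj, List.mem_ofFn, forall_exists_index,
    forall_apply_eq_imp_iff, true_atomAt]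

theorem true_ex (M : Model P) (ψ : Fml P 1) :
    M.True ψ.ex ↔ ∃ d : M.Dom, M.Sat ψ (fun _ => d) := by
  refine exists_congr fun d => iff_of_eq (congrArg _ ?_)
  funext i
  simp [Fin.snoc]

theorem true_inst (M : Model P) (ψ : Fml P 1) (c : ℕ) :
    M.True (ψ.inst c) ↔ M.Sat ψ (fun _ => M.const c) := sat_subst M ψ _ _

/-! ### Elementary properties of probability functions -/

/-- Symmetric difference of sentences. -/
def sdiff (θ φ : Sentence P) : Sentence P := (θ.and φ.neg).or (φ.and θ.neg)

theorem true_sdiff (M : Model P) (θ φ : Sentence P) :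
    M.True (sdiff θ φ) ↔ ¬ (M.True θ ↔ M.True φ) := by
  change (_ ∧ ¬ _) ∨ (_ ∧ ¬ _) ↔ _
  unfold Model.True
  tauto

namespace IsProbFun

variable {w w₁ w₂ : Sentence P → ℝ} {θ φ θ' φ' : Sentence P}

theorem nonneg (hw : IsProbFun w) (θ) : 0 ≤ w θ := (hw.mem_Icc θ).1

theorem le_one (hw : IsProbFun w) (θ) : w θ ≤ 1 := (hw.mem_Icc θ).2

theorem neg (hw : IsProbFun w) (θ : Sentence P) : w θ.neg = 1 - w θ := by
  have h1 := hw.add θ θ.neg fun M h h' => h' h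
  have h2 := hw.valid (θ.or θ.neg) fun M => em _
  linarith

theorem mono (hw : IsProbFun w) (h : Entails θ φ) : w θ ≤ w φ := by
  have h1 := hw.add θ φ.neg fun M hθ hφ => hφ (h M hθ)
  have h2 := hw.le_one (θ.or φ.neg)
  have h3 := hw.neg φ
  linarith

theorem congr (hw : IsProbFun w) (h : ∀ M : Model P, M.True θ ↔ M.True φ) : w θ = w φ :=
  le_antisymm (hw.mono fun M => (h M).1) (hw.mono fun M => (h M).2)

theorem or_le (hw : IsProbFun w) (θ φ) : w (θ.or φ) ≤ w θ + w φ := by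
  have h1 : w (θ.or φ) = w (θ.or (φ.and θ.neg)) := hw.congr fun M => by
    change (_ ∨ _) ↔ (_ ∨ (_ ∧ ¬ _))
    tauto
  have h2 : Entails θ (φ.and θ.neg).neg := fun M h h' => h'.2 h
  rw [h1, hw.add _ _ h2]
  gcongr
  exact hw.mono fun M h => h.1

theorem false_eq_zero (hw : IsProbFun w) : w (Fml.neg Fml.top) = 0 := by
  have h : Valid (Fml.top : Sentence P) := fun M => True.intro
  rw [hw.neg, hw.valid _ h, sub_self]

theorem le_add_sdiff (hw : IsProbFun w) (θ φ) : w θ ≤ w φ + w (sdiff θ φ) := by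
  refine (hw.mono fun M h => ?_).trans (hw.or_le φ (sdiff θ φ))
  change M.True φ ∨ M.True (sdiff θ φ)
  rw [true_sdiff]
  tauto

theorem sdiff_comm (hw : IsProbFun w) (θ φ) : w (sdiff θ φ) = w (sdiff φ θ) :=
  hw.congr fun M => by rw [true_sdiff, true_sdiff, iff_comm (a := M.True θ)]

theorem abs_sub_le (hw : IsProbFun w) (θ φ) : |w θ - w φ| ≤ w (sdiff θ φ) := by
  have h1 := hw.le_add_sdiff θ φ
  have h2 := hw.le_add_sdiff φ θ
  rw [hw.sdiff_comm φ θ] at h2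
  exact abs_sub_le_iff.2 ⟨by linarith, by linarith⟩

theorem sdiff_triangle (hw : IsProbFun w) (θ φ χ) :
    w (sdiff θ χ) ≤ w (sdiff θ φ) + w (sdiff φ χ) := by
  refine (hw.mono fun M h => ?_).trans (hw.or_le _ _)
  change M.True (sdiff θ φ) ∨ M.True (sdiff φ χ)
  rw [true_sdiff] at h ⊢
  rw [true_sdiff]
  tauto

theorem average (h₁ : IsProbFun w₁) (h₂ : IsProbFun w₂) :
    IsProbFun fun θ => (w₁ θ + w₂ θ) / 2 where
  mem_Icc θ := by
    have a := h₁.mem_Icc θ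
    have b := h₂.mem_Icc θ
    constructor <;> linarith [a.1, a.2, b.1, b.2]
  valid θ h := by rw [h₁.valid θ h, h₂.valid θ h]; norm_num
  add θ φ h := by rw [h₁.add θ φ h, h₂.add θ φ h]; ring
  exists_lim ψ := ((h₁.exists_lim ψ).add (h₂.exists_lim ψ)).div_const 2

end IsProbFun

/-- Finite disjunctions. -/
def disjList (l : List (Sentence P)) : Sentence P := l.foldr Fml.or Fml.top.neg

theorem true_disjList (M : Model P) (l : List (Sentence P)) :
    M.True (disjList l) ↔ ∃ φ ∈ l, M.True φ := by
  induction l with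
  | nil => exact iff_of_false (fun h => h trivial) (by simp)
  | cons φ l ih =>
    simp only [List.mem_cons, exists_eq_or_imp, ← ih]
    rfl

theorem IsProbFun.disjList_map {w : Sentence P → ℝ} (hw : IsProbFun w) {ι : Type}
    (T : ι → Sentence P) (hT : ∀ M : Model P, ∀ a b, M.True (T a) → M.True (T b) → a = b)
    (l : List ι) (hl : l.Nodup) : w (disjList (l.map T)) = (l.map fun a => w (T a)).sum := by
  induction l with
  | nil => exact hw.false_eq_zero
  | cons a l ih =>
    rw [List.nodup_cons] at hl
    rw [List.map_cons, List.map_cons, List.sum_cons, ← ih hl.2]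
    refine hw.add _ _ fun M h h' => ?_
    obtain ⟨φ, hφ, h''⟩ := (true_disjList M _).1 h'
    obtain ⟨b, hb, rfl⟩ := List.mem_map.1 hφ
    exact hl.1 (hT M _ _ h h'' ▸ hb)

/-! ### Sentences about finitely many constants -/

/-- The truth of `χ` depends on the properties of the first `n` constants only. -/
def Finitary (n : ℕ) (χ : Sentence P) : Prop :=
  ∀ M M' : Model P, (∀ p, ∀ j < n, (M.pred p (M.const j) ↔ M'.pred p (M'.const j))) →
    (M.True χ ↔ M'.True χ)

theorem Finitary.mono {n m : ℕ} {χ : Sentence P} (h : Finitary n χ) (hnm : n ≤ m) :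
    Finitary m χ := fun M M' hM => h M M' fun p j hj => hM p j (hj.trans_le hnm)

/-- A structure whose first `n` elements are as described by `h`. -/
def extModel {n : ℕ} (h : Fin n → P → Bool) : Model P where
  Dom := ℕ
  pred p d := ∃ hd : d < n, h ⟨d, hd⟩ p = true
  const := id

open Classical in
-- The state descriptions of the first n constants exclude each other and exhaust all structures, so
-- χ is equivalent to the disjunction of those that decide it positively.
theorem IsProbFun.finitary_eq_sum [Fintype P] {w : Sentence P → ℝ}
    (hw : IsProbFun w) {n : ℕ} {χ : Sentence P} (hχ : Finitary n χ) :
    w χ = ∑ h : Fin n → P → Bool,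
      if (extModel h).True χ then w (stateDesc h Fin.val) else 0 := by
  have hT : ∀ M : Model P, ∀ a b : Fin n → P → Bool,
      M.True (stateDesc a Fin.val) → M.True (stateDesc b Fin.val) → a = b := by
    intro M a b ha hb
    rw [true_stateDesc] at ha hb
    funext j p
    have := (ha j p).symm.trans (hb j p)
    revert this
    cases a j p <;> cases b j p <;> simp
  have key : ∀ (M : Model P) (h : Fin n → P → Bool), M.True (stateDesc h Fin.val) →
      ((extModel h).True χ ↔ M.True χ) := by
    intro M h hM
    rw [true_stateDesc] at hM
    refine hχ _ _ fun p j hj => ?_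
    rw [hM ⟨j, hj⟩ p]
    simp [extModel, hj]
  rw [← Finset.sum_filter, ← Finset.sum_map_toList, ← hw.disjList_map _ hT _ (Finset.nodup_toList _)]
  refine hw.congr fun M => ?_
  rw [true_disjList]
  constructor
  · intro hM
    let h : Fin n → P → Bool := fun j p => decide (M.pred p (M.const j))
    have hh : M.True (stateDesc h Fin.val) := (true_stateDesc _ _ _).2 fun j p => by simp [h]
    exact ⟨_, List.mem_map.2 ⟨h, by simpa using (key M h hh).2 hM, rfl⟩, hh⟩
  · rintro ⟨φ, hφ, hM⟩
    obtain ⟨h, hh, rfl⟩ := List.mem_map.1 hφ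
    exact (key M h hM).1 (by simpa using hh)

/-- `θ` is approximated in probability by sentences about finitely many constants. -/
def Approx (w : Sentence P → ℝ) (θ : Sentence P) : Prop :=
  ∀ ε > 0, ∃ χ, (∃ n, Finitary n χ) ∧ w (sdiff θ χ) < ε

namespace Approx

variable {w : Sentence P → ℝ} {θ φ : Sentence P}

theorem of_finitary (hw : IsProbFun w) {n : ℕ} (h : Finitary n θ) : Approx w θ :=
  fun ε hε => ⟨θ, ⟨n, h⟩, by
    rw [hw.congr (φ := Fml.top.neg) fun M => ?_, hw.false_eq_zero]
    · exact hε
    · rw [true_sdiff]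
      exact iff_of_false (by simp) (fun h => h trivial)⟩

theorem congr (hw : IsProbFun w) (h : Approx w θ) (h' : ∀ M : Model P, M.True θ ↔ M.True φ) :
    Approx w φ := fun ε hε => by
  obtain ⟨χ, hχ, hε⟩ := h ε hε
  refine ⟨χ, hχ, lt_of_eq_of_lt (hw.congr fun M => ?_) hε⟩
  rw [true_sdiff, true_sdiff, h']

theorem neg (hw : IsProbFun w) (h : Approx w θ) : Approx w θ.neg := fun ε hε => by
  obtain ⟨χ, ⟨n, hχ⟩, hε⟩ := h ε hε
  refine ⟨χ.neg, ⟨n, fun M M' hM => not_congr (hχ M M' hM)⟩,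
    lt_of_eq_of_lt (hw.congr fun M => ?_) hε⟩
  rw [true_sdiff, true_sdiff]
  change ¬ (¬ M.True θ ↔ ¬ M.True χ) ↔ _
  tauto

theorem and (hw : IsProbFun w) (h : Approx w θ) (h' : Approx w φ) : Approx w (θ.and φ) :=
  fun ε hε => by
  obtain ⟨χ, ⟨n, hχ⟩, h1⟩ := h (ε / 2) (half_pos hε)
  obtain ⟨χ', ⟨n', hχ'⟩, h2⟩ := h' (ε / 2) (half_pos hε)
  refine ⟨χ.and χ', ⟨max n n', fun M M' hM => and_congr (hχ.mono (le_max_left _ _) M M' hM)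
    (hχ'.mono (le_max_right _ _) M M' hM)⟩, ?_⟩
  refine ((hw.mono fun M h => ?_).trans (hw.or_le (sdiff θ χ) (sdiff φ χ'))).trans_lt (by linarith)
  change M.True (sdiff θ χ) ∨ M.True (sdiff φ χ')
  rw [true_sdiff] at h ⊢
  rw [true_sdiff]
  change ¬ (M.True θ ∧ M.True φ ↔ M.True χ ∧ M.True χ') at h
  tauto

theorem or (hw : IsProbFun w) (h : Approx w θ) (h' : Approx w φ) : Approx w (θ.or φ) :=
  (((h.neg hw).and hw (h'.neg hw)).neg hw).congr hw fun M => by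
    change ¬ (¬ M.True θ ∧ ¬ M.True φ) ↔ M.True θ ∨ M.True φ
    tauto

theorem disj (hw : IsProbFun w) {θ : ℕ → Sentence P} (h : ∀ j, Approx w (θ j)) (n : ℕ) :
    Approx w (Fml.disj θ n) := by
  induction n with
  | zero => exact h 0
  | succ n ih => exact ih.or hw (h _)

/-- This is where (P3) enters: finite disjunctions of instances imply `ψ.ex`, so the symmetric
difference has as its probability the gap between the two values, which tends to 0. -/
theorem ex (hw : IsProbFun w) {ψ : Fml P 1} (h : ∀ j, Approx w (ψ.inst j)) : Approx w ψ.ex :=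
  fun ε hε => by
  obtain ⟨n, hn⟩ := ((hw.exists_lim ψ).eventually
    (lt_mem_nhds (show w ψ.ex - ε / 2 < w ψ.ex by linarith))).exists
  obtain ⟨χ, hχ, h1⟩ := disj hw h n (ε / 2) (half_pos hε)
  refine ⟨χ, hχ, (hw.sdiff_triangle _ (Fml.disj (fun j => ψ.inst j) n) _).trans_lt ?_⟩
  have hent : ∀ M : Model P, M.True (Fml.disj (fun j => ψ.inst j) n) → M.True ψ.ex := by
    intro M hM
    obtain ⟨j, -, hj⟩ := (true_disj M _ n).1 hM
    exact (true_ex M ψ).2 ⟨_, (true_inst M ψ j).1 hj⟩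
  have h2 := hw.add (Fml.disj (fun j => ψ.inst j) n)
    (sdiff ψ.ex (Fml.disj (fun j => ψ.inst j) n)) fun M h h' => by
      have h' : M.True (sdiff _ _) := h'
      rw [true_sdiff] at h'
      exact h' (iff_of_true (hent M h) h)
  have h3 : w ((Fml.disj (fun j => ψ.inst j) n).or (sdiff ψ.ex (Fml.disj (fun j => ψ.inst j) n)))
      = w ψ.ex := hw.congr fun M => by
    change M.True _ ∨ M.True (sdiff _ _) ↔ _
    rw [true_sdiff]
    have := hent M
    tauto
  linarith

end Approx

/-- Only sentences have probabilities, so the induction runs over formulas with constants put for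
their variables; an instance of a quantifier extends that substitution by one constant. -/
theorem IsProbFun.approx_subst {w : Sentence P → ℝ} (hw : IsProbFun w) {n : ℕ} (φ : Fml P n)
    (s : Fin n → ℕ) : Approx w (φ.subst (m := 0) fun i => Sum.inl (s i)) := by
  induction φ with
  | top => exact .of_finitary hw (n := 0) fun M M' _ => Iff.rfl
  | rel p t =>
    cases t with
    | inl j => exact .of_finitary hw (n := j + 1) fun M M' h => h p j (Nat.lt_succ_self j)
    | inr i => exact .of_finitary hw (n := s i + 1) fun M M' h => h p (s i) (Nat.lt_succ_self _)
  | neg φ ih => exact (ih s).neg hw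
  | and φ ψ ih ih' => exact (ih s).and hw (ih' s)
  | or φ ψ ih ih' => exact (ih s).or hw (ih' s)
  | ex φ ih =>
    refine Approx.ex hw fun j => (ih (Fin.snoc (α := fun _ => ℕ) s j)).congr hw fun M => ?_
    rw [true_inst]
    refine (sat_subst M φ _ _).trans (Iff.trans (iff_of_eq (congrArg _ ?_)) (sat_subst M φ _ _).symm)
    funext i
    refine Fin.lastCases ?_ (fun i => ?_) i <;> simp [liftSubst]

theorem IsProbFun.approx {w : Sentence P → ℝ} (hw : IsProbFun w) (φ : Sentence P) : Approx w φ :=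
  (hw.approx_subst φ Fin.elim0).congr hw fun M =>
    (sat_subst M φ _ _).trans (iff_of_eq (congrArg _ (Subsingleton.elim _ _)))

/-- A probability function is determined by its values at state descriptions. -/
theorem IsProbFun.ext_stateDesc [Fintype P] {w₁ w₂ : Sentence P → ℝ}
    (h₁ : IsProbFun w₁) (h₂ : IsProbFun w₂)
    (h : ∀ (n : ℕ) (h : Fin n → P → Bool),
      w₁ (stateDesc h Fin.val) = w₂ (stateDesc h Fin.val)) : w₁ = w₂ := by
  funext θ
  refine eq_of_abs_sub_le_all fun ε hε => ?_
  -- Approximation under the average yields one χ that serves both functions: their values at the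
  -- symmetric difference sum to less than ε / 2.
  obtain ⟨χ, ⟨n, hχ⟩, hlt⟩ := (h₁.average h₂).approx θ (ε / 4) (by linarith)
  have e : w₁ χ = w₂ χ := by
    classical rw [h₁.finitary_eq_sum hχ, h₂.finitary_eq_sum hχ]
    simp only [h]
  have a1 := h₁.abs_sub_le θ χ
  have a2 := h₂.abs_sub_le θ χ
  have p1 := h₁.nonneg (sdiff θ χ)
  have p2 := h₂.nonneg (sdiff θ χ)
  rw [abs_le] at *
  constructor <;> linarith [a1.1, a1.2, a2.1, a2.2]

/-! ### Probability functions from random structures -/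

/-- The structure with domain `ℕ` given by the rows `f p` and the columns `g d` of `ω`. -/
def canon (f : P → ℕ) (g : ℕ → ℕ) (ω : ℕ → ℕ → Bool) : Model P where
  Dom := ℕ
  pred p d := ω (f p) (g d) = true
  const := id

theorem measurableSet_sat (f : P → ℕ) (g : ℕ → ℕ) {n : ℕ} (φ : Fml P n) (v : Fin n → ℕ) :
    MeasurableSet {ω | (canon f g ω).Sat φ v} := by
  induction φ with
  | top => exact MeasurableSet.univ
  | rel p t =>
    have : Measurable fun ω : ℕ → ℕ → Bool => ω (f p) (g (Sum.elim id v t)) := by fun_prop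
    exact this (measurableSet_singleton true)
  | neg φ ih => exact (ih v).compl
  | and φ ψ ih ih' => exact (ih v).inter (ih' v)
  | or φ ψ ih ih' => exact (ih v).union (ih' v)
  | ex φ ih =>
    have : {ω | (canon f g ω).Sat φ.ex v} = ⋃ d : ℕ,
        {ω | (canon f g ω).Sat φ (Fin.snoc (α := fun _ => ℕ) v d)} := by
      ext ω
      simp only [Set.mem_iUnion]
      rfl
    rw [this]
    exact MeasurableSet.iUnion fun d => ih _

theorem measurableSet_true (f : P → ℕ) (g : ℕ → ℕ) (φ : Sentence P) :
    MeasurableSet {ω | (canon f g ω).True φ} := measurableSet_sat f g φ Fin.elim0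

/-- Every element of the domain is named by a constant, so an existential event is the increasing
union of the events of its finite disjunctions, and (P3) is continuity from below. -/
theorem isProbFun_of_measure (μ : Measure (ℕ → ℕ → Bool)) [IsProbabilityMeasure μ] (f : P → ℕ)
    (g : ℕ → ℕ) : IsProbFun fun θ : Sentence P => μ.real {ω | (canon f g ω).True θ} where
  mem_Icc θ := ⟨measureReal_nonneg, measureReal_le_one⟩
  valid θ h := by
    have : {ω | (canon f g ω).True θ} = Set.univ := Set.eq_univ_of_forall fun ω => h _
    rw [this, probReal_univ]
  add θ φ h := by
    refine measureReal_union (Set.disjoint_left.2 fun ω h1 h2 => h _ h1 h2)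
      (measurableSet_true f g φ)
  exists_lim ψ := by
    have : {ω | (canon f g ω).True ψ.ex} =
        ⋃ n, {ω | (canon f g ω).True (Fml.disj (fun j => ψ.inst j) n)} := by
      ext ω
      simp only [Set.mem_iUnion, Set.mem_ofPred_eq, true_disj, true_inst, true_ex]
      exact ⟨fun ⟨d, hd⟩ => ⟨d, d, le_rfl, hd⟩, fun ⟨n, j, _, hj⟩ => ⟨j, hj⟩⟩
    simp only [this]
    refine (ENNReal.tendsto_toReal (measure_ne_top _ _)).comp
      (tendsto_measure_iUnion_atTop fun n m hnm ω hω => ?_)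
    simp only [Set.mem_ofPred_eq, true_disj] at hω ⊢
    obtain ⟨j, hj, h⟩ := hω
    exact ⟨j, hj.trans hnm, h⟩

theorem true_canon_stateDesc [Fintype P] (f : P → ℕ) (g : ℕ → ℕ) (ω : ℕ → ℕ → Bool) {n : ℕ}
    (h : Fin n → P → Bool) (i : Fin n → ℕ) :
    (canon f g ω).True (stateDesc h i) ↔ ∀ j p, ω (f p) (g (i j)) = h j p := by
  rw [true_stateDesc]
  refine forall_congr' fun j => forall_congr' fun p => ?_
  exact Bool.eq_iff_iff.symm

/-! ### Sampling rows and columns of a finite matrix -/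

theorem productFun_eq_prod {P : Type} [Fintype P] [DecidableEq P] (x : (P → Bool) → ℝ) {n : ℕ}
    (h : Fin n → P → Bool) : productFun x h = ∏ j, x (h j) := by
  rw [productFun, ← Finset.prod_fiberwise' (s := Finset.univ) (g := h) (f := x)]
  simp only [Finset.prod_const]

/-- A column frequency is the mean of an indicator over columns; multiplying out the n factors gives
a mean over all choices of n columns, repetitions included. -/
theorem nablaFin_eq_sum {P : Type} [Fintype P] [DecidableEq P] {m : ℕ}
    (M : Fin m → Fin m → Bool) {n : ℕ} (h : Fin n → P → Bool) :
    nablaFin M h = ∑ e : P → Fin m, ∑ c : Fin n → Fin m,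
      1 / (m : ℝ) ^ Fintype.card P * (1 / (m : ℝ) ^ n *
        if ∀ j p, M (e p) (c j) = h j p then 1 else 0) := by
  refine Finset.sum_congr rfl fun e _ => ?_
  rw [← Finset.mul_sum]
  congr 1
  rw [productFun_eq_prod, ← Finset.mul_sum]
  have key : ∀ j, colFreq M e (h j) =
      ∑ c : Fin m, 1 / (m : ℝ) * if ∀ p, M (e p) c = h j p then 1 else 0 := fun j => by
    rw [colFreq, ← Finset.mul_sum, Finset.sum_boole, div_eq_inv_mul, one_div]
  simp only [key]
  rw [Finset.prod_univ_sum, Fintype.piFinset_univ, Finset.mul_sum]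
  refine Finset.sum_congr rfl fun c _ => ?_
  rw [Finset.prod_mul_distrib, Finset.prod_const, Finset.card_univ, Fintype.card_fin, one_div_pow,
    Finset.prod_boole]
  simp

/-- The distribution of a sequence of independent uniformly distributed elements of `Fin m`. -/
noncomputable def uniformSeq (m : ℕ) [Nonempty (Fin m)] : Measure (ℕ → Fin m) :=
  Measure.infinitePi fun _ => (PMF.uniformOfFintype (Fin m)).toMeasure

instance (m : ℕ) [Nonempty (Fin m)] : IsProbabilityMeasure (uniformSeq m) := by
  unfold uniformSeq
  infer_instance

theorem uniformSeq_cylinder (m : ℕ) [Nonempty (Fin m)] {J : Type} [Fintype J] (f : J → ℕ)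
    (hf : Function.Injective f) (e : J → Fin m) :
    (uniformSeq m).real {a | ∀ p, a (f p) = e p} = 1 / (m : ℝ) ^ Fintype.card J := by
  classical
  have hset : {a : ℕ → Fin m | ∀ p, a (f p) = e p} =
      Set.pi (Finset.univ.image f : Finset ℕ) (fun i => {x | ∀ p, f p = i → x = e p}) := by
    ext a
    simp only [Set.mem_ofPred_eq, Set.mem_pi, Finset.coe_image, Finset.coe_univ, Set.image_univ,
      Set.mem_range, forall_exists_index, forall_apply_eq_imp_iff]
    exact ⟨fun h p p' hp => hf hp ▸ h p, fun h p => h p p rfl⟩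
  rw [hset, measureReal_def, uniformSeq, Measure.infinitePi_pi _ fun i _ => .of_discrete,
    Finset.prod_image fun p _ p' _ h => hf h]
  have : ∀ p, {x : Fin m | ∀ p', f p' = f p → x = e p'} = {e p} := fun p => by
    ext x
    exact ⟨fun h => h p rfl, fun h p' hp => by rw [hf hp]; exact h⟩
  simp only [this]
  rw [Finset.prod_congr rfl fun p _ => PMF.toMeasure_apply_singleton _ _ .of_discrete]
  simp [ENNReal.toReal_pow]

theorem measurable_array {m : ℕ} (M : Fin m → Fin m → Bool) :
    Measurable fun (x : (ℕ → Fin m) × (ℕ → Fin m)) (p j : ℕ) => M (x.1 p) (x.2 j) := by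
  refine measurable_pi_lambda _ fun p => measurable_pi_lambda _ fun j => ?_
  have h1 : Measurable fun y : Fin m × Fin m => M y.1 y.2 := .of_discrete
  have h2 : Measurable fun x : (ℕ → Fin m) × (ℕ → Fin m) => (x.1 p, x.2 j) := by fun_prop
  exact h1.comp h2

open Classical in
/-- The distribution of the array `M (e p) (c j)` for independent uniformly distributed `e p`
and `c j`. -/
noncomputable def sampleMeasure {m : ℕ} (M : Fin m → Fin m → Bool) : ProbabilityMeasure (ℕ → ℕ → Bool) :=
  if _h : Nonempty (Fin m) then
    ⟨((uniformSeq m).prod (uniformSeq m)).map fun x p j => M (x.1 p) (x.2 j),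
      Measure.isProbabilityMeasure_map (measurable_array M).aemeasurable⟩
  -- An arbitrary value for m = 0, where nothing can be drawn; it is irrelevant in the limit when
  -- `N` tends to infinity.
  else ⟨Measure.dirac fun _ _ => true, inferInstance⟩

/-- The arrays whose entries at the rows `f p` and the columns `i j` are given by `h`. -/
def pattern {P : Type} (f : P → ℕ) {n : ℕ} (i : Fin n → ℕ) (h : Fin n → P → Bool) :
    Set (ℕ → ℕ → Bool) := {ω | ∀ j p, ω (f p) (i j) = h j p}

theorem isClopen_pattern {P : Type} [Finite P] (f : P → ℕ) {n : ℕ} (i : Fin n → ℕ)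
    (h : Fin n → P → Bool) : IsClopen (pattern f i h) := by
  have : pattern f i h = ⋂ j, ⋂ p, (fun ω : ℕ → ℕ → Bool => ω (f p) (i j)) ⁻¹' {h j p} := by
    ext ω
    simp [pattern]
  rw [this]
  refine isClopen_iInter_of_finite fun j => isClopen_iInter_of_finite fun p => ?_
  exact (isClopen_discrete _).preimage (by fun_prop)

theorem sampleMeasure_pattern {P : Type} [Fintype P] [DecidableEq P] {m : ℕ} (hm : 0 < m)
    (M : Fin m → Fin m → Bool) {f : P → ℕ} (hf : Function.Injective f) {n : ℕ} {i : Fin n → ℕ}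
    (hi : Function.Injective i) (h : Fin n → P → Bool) :
    (sampleMeasure M : Measure (ℕ → ℕ → Bool)).real (pattern f i h) = nablaFin M h := by
  have : Nonempty (Fin m) := ⟨⟨0, hm⟩⟩
  have hM : (sampleMeasure M : Measure (ℕ → ℕ → Bool)) =
      ((uniformSeq m).prod (uniformSeq m)).map fun x p j => M (x.1 p) (x.2 j) :=
    congrArg ProbabilityMeasure.toMeasure (dif_pos this)
  rw [hM, nablaFin_eq_sum]
  rw [map_measureReal_apply (measurable_array M)
    (isClopen_pattern f i h).isOpen.measurableSet]
  let A (e : P → Fin m) : Set (ℕ → Fin m) := {a | ∀ p, a (f p) = e p}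
  let B (c : Fin n → Fin m) : Set (ℕ → Fin m) := {b | ∀ j, b (i j) = c j}
  -- The event splits into disjoint cylinders, one for each choice of rows and columns of M that
  -- shows the pattern.
  have hset : (fun (x : (ℕ → Fin m) × (ℕ → Fin m)) (p j : ℕ) => M (x.1 p) (x.2 j)) ⁻¹'
      pattern f i h = ⋃ y ∈ Finset.univ.filter (fun y : (P → Fin m) × (Fin n → Fin m) =>
        ∀ j p, M (y.1 p) (y.2 j) = h j p), A y.1 ×ˢ B y.2 := by
    ext x
    simp only [Set.mem_preimage, pattern, Set.mem_ofPred_eq, Set.mem_iUnion, Finset.mem_filter,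
      Finset.mem_univ, true_and, Set.mem_prod, A, B]
    constructor
    · intro hx
      exact ⟨(fun p => x.1 (f p), fun j => x.2 (i j)), hx, fun _ => rfl, fun _ => rfl⟩
    · rintro ⟨y, hy, h1, h2⟩ j p
      rw [h1, h2, hy]
  have hA : ∀ e, MeasurableSet (A e) := fun e => by
    have : A e = ⋂ p, (fun a : ℕ → Fin m => a (f p)) ⁻¹' {e p} := by ext; simp [A]
    rw [this]
    exact .iInter fun p => measurable_pi_apply (f p) .of_discrete
  have hB : ∀ c, MeasurableSet (B c) := fun c => by
    have : B c = ⋂ j, (fun a : ℕ → Fin m => a (i j)) ⁻¹' {c j} := by ext; simp [B]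
    rw [this]
    exact .iInter fun p => measurable_pi_apply (i p) .of_discrete
  rw [hset, measureReal_biUnion_finset, Finset.sum_filter, ← Finset.univ_product_univ,
    Finset.sum_product]
  · refine Finset.sum_congr rfl fun e _ => Finset.sum_congr rfl fun c _ => ?_
    split_ifs
    · rw [measureReal_prod_prod, uniformSeq_cylinder m f hf, uniformSeq_cylinder m i hi,
        Fintype.card_fin, mul_one]
    · simp
  · intro y _ y' _ hne
    refine Set.disjoint_left.2 fun x hx hx' => hne ?_
    refine Prod.ext (funext fun p => ?_) (funext fun j => ?_)
    · exact (hx.1 p).symm.trans (hx'.1 p)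
    · exact (hx.2 j).symm.trans (hx'.2 j)
  · exact fun y _ => (hA _).prod (hB _)

/-! ### The random array of a hyperfinite matrix -/

section Ultrapower

variable {I : Type*} {U : Ultrafilter I} {N : I → ℕ}

theorem exists_tendsto_of_compact {X : Type*} [TopologicalSpace X] [CompactSpace X] (U : Ultrafilter I)
    (x : I → X) : ∃ a, Tendsto x U (𝓝 a) := by
  obtain ⟨a, -, ha⟩ := isCompact_univ.ultrafilter_le_nhds (U.map x) (by simp)
  exact ⟨a, ha⟩

/-- A representative of a hyperfinite matrix. -/
noncomputable def HyperStateDesc.rep (Y : HyperStateDesc U N) (k : I) : Fin (N k) → Fin (N k) → Bool :=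
  Quotient.out (s := productSetoid (U : Filter I) _) Y k

theorem HyperStateDesc.mk_rep (Y : HyperStateDesc U N) :
    Quotient.mk (productSetoid (U : Filter I) _) Y.rep = Y := Quotient.out_eq _

theorem mem_internalSet {S : (k : I) → Set (Fin (N k) → Fin (N k) → Bool)}
    {Y : HyperStateDesc U N} : Y ∈ internalSet U N S ↔ ∀ᶠ k in (U : Filter I), Y.rep k ∈ S k := by
  constructor
  · rintro ⟨f, rfl, hf⟩
    have h : ∀ᶠ k in (U : Filter I), HyperStateDesc.rep
        (Quotient.mk (productSetoid (U : Filter I) _) f) k = f k :=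
      Quotient.mk_out (s := productSetoid (U : Filter I) _) f
    filter_upwards [h, hf] with k h1 h2
    rwa [h1]
  · exact fun h => ⟨Y.rep, Y.mk_rep, h⟩

theorem mk_mem_internalSet {S : (k : I) → Set (Fin (N k) → Fin (N k) → Bool)}
    {f : (k : I) → Fin (N k) → Fin (N k) → Bool} (h : ∀ᶠ k in (U : Filter I), f k ∈ S k) :
    (Quotient.mk (productSetoid (U : Filter I) _) f : HyperStateDesc U N) ∈ internalSet U N S :=
  ⟨f, rfl, h⟩

theorem stdPart_of_tendsto {x : I → ℝ} {r : ℝ} (h : Tendsto x U (𝓝 r)) :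
    ArchimedeanClass.stdPart (x : Germ (U : Filter I) ℝ) = r := by
  let c : ℝ →+*o Germ (U : Filter I) ℝ :=
    { toFun := fun x => (x : Germ (U : Filter I) ℝ)
      map_zero' := rfl
      map_one' := rfl
      map_add' := fun _ _ => rfl
      map_mul' := fun _ _ => rfl
      monotone' := fun _ _ h => Germ.const_le h }
  refine ArchimedeanClass.stdPart_eq c (fun s hs => ?_) fun s hs => ?_
  · exact Germ.coe_le.2 ((h.eventually (lt_mem_nhds hs)).mono fun _ => le_of_lt)
  · exact Germ.coe_le.2 ((h.eventually (gt_mem_nhds hs)).mono fun _ => le_of_lt)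

/-- The limit along the ultrafilter of the distributions of the sampled arrays. -/
noncomputable def limitMeasure (Y : HyperStateDesc U N) : ProbabilityMeasure (ℕ → ℕ → Bool) :=
  -- The array space is compact, hence so is its space of probability measures with the weak
  -- topology.
  (exists_tendsto_of_compact U fun k => sampleMeasure (Y.rep k)).choose

theorem tendsto_sampleMeasure (Y : HyperStateDesc U N) {C : Set (ℕ → ℕ → Bool)} (hC : IsClopen C) :
    Tendsto (fun k => (sampleMeasure (Y.rep k) : Measure (ℕ → ℕ → Bool)).real C) U
      (𝓝 ((limitMeasure Y : Measure (ℕ → ℕ → Bool)).real C)) := by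
  have := ProbabilityMeasure.tendsto_measure_of_null_frontier_of_tendsto'
    (exists_tendsto_of_compact U fun k => sampleMeasure (Y.rep k)).choose_spec (E := C)
    (by rw [hC.frontier_eq, measure_empty])
  exact (ENNReal.tendsto_toReal (measure_ne_top _ _)).comp this

/-- The left side does not mention f or i: the limit law gives a pattern the same probability in any
distinct rows and columns. Ex, Px and language invariance all come from this. -/
theorem stdPart_nabla (hN : Tendsto N (U : Filter I) atTop) {P : Type} [Fintype P] [DecidableEq P]
    (Y : HyperStateDesc U N) {f : P → ℕ} (hf : Function.Injective f) {n : ℕ} {i : Fin n → ℕ}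
    (hi : Function.Injective i) (h : Fin n → P → Bool) :
    ArchimedeanClass.stdPart (nabla U N Y h) =
      (limitMeasure Y : Measure (ℕ → ℕ → Bool)).real (pattern f i h) := by
  have h1 : nabla U N Y h =
      ((fun k => nablaFin (Y.rep k) h : I → ℝ) : Germ (U : Filter I) ℝ) := by
    conv_lhs => rw [← Y.mk_rep]
    rfl
  rw [h1]
  refine stdPart_of_tendsto ((tendsto_sampleMeasure Y (isClopen_pattern f i h)).congr' ?_)
  filter_upwards [hN.eventually_ge_atTop 1] with k hk
  exact sampleMeasure_pattern hk _ hf hi h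

theorem extendsStNabla_limitMeasure (hN : Tendsto N (U : Filter I) atTop) {P : Type} [Fintype P]
    [DecidableEq P] (Y : HyperStateDesc U N) {f : P → ℕ} (hf : Function.Injective f) {g : ℕ → ℕ}
    (hg : Function.Injective g) :
    ExtendsStNabla U N Y fun θ : Sentence P =>
      (limitMeasure Y : Measure (ℕ → ℕ → Bool)).real {ω | (canon f g ω).True θ} := by
  refine ⟨isProbFun_of_measure _ f g, fun n h i hi => ?_⟩
  rw [stdPart_nabla hN Y hf (hg.comp hi) h]
  simp only [true_canon_stateDesc]
  rfl

theorem ExtendsStNabla.eq {P : Type} [Fintype P] [DecidableEq P] {Y : HyperStateDesc U N}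
    {v v' : Sentence P → ℝ} (h : ExtendsStNabla U N Y v) (h' : ExtendsStNabla U N Y v') : v = v' :=
  h.1.ext_stateDesc h'.1 fun n d => by
    rw [h.2 n d _ Fin.val_injective, h'.2 n d _ Fin.val_injective]

/-- By uniqueness of the extension, °∇ can be computed with whichever injections f and g suit the
purpose. -/
theorem stNabla_eq (hN : Tendsto N (U : Filter I) atTop) {P : Type} [Fintype P]
    [DecidableEq P] (Y : HyperStateDesc U N) {f : P → ℕ} (hf : Function.Injective f) {g : ℕ → ℕ}
    (hg : Function.Injective g) (θ : Sentence P) :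
    stNabla U N Y θ = (limitMeasure Y : Measure (ℕ → ℕ → Bool)).real {ω | (canon f g ω).True θ} :=
  congrFun (ExtendsStNabla.eq (Classical.epsilon_spec (p := ExtendsStNabla U N Y)
    ⟨_, extendsStNabla_limitMeasure hN Y hf hg⟩) (extendsStNabla_limitMeasure hN Y hf hg)) θ

theorem existsUnique_extendsStNabla (hN : Tendsto N (U : Filter I) atTop) {P : Type} [Fintype P]
    [DecidableEq P] (Y : HyperStateDesc U N) {f : P → ℕ} (hf : Function.Injective f) :
    ∃! v : Sentence P → ℝ, ExtendsStNabla U N Y v :=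
  ⟨_, extendsStNabla_limitMeasure hN Y hf Function.injective_id, fun _ h =>
    h.eq (extendsStNabla_limitMeasure hN Y hf Function.injective_id)⟩

/-! ### Measurability and invariance of °∇ -/

theorem measurableSet_internalSet (S : (k : I) → Set (Fin (N k) → Fin (N k) → Bool)) :
    MeasurableSet (internalSet U N S) := MeasurableSpace.measurableSet_generateFrom ⟨S, rfl⟩

/-- The standard part of an internal function is measurable. -/
theorem measurable_of_tendsto_rep {F : (k : I) → (Fin (N k) → Fin (N k) → Bool) → ℝ}
    {G : HyperStateDesc U N → ℝ}
    (h : ∀ Y : HyperStateDesc U N, Tendsto (fun k => F k (Y.rep k)) U (𝓝 (G Y))) :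
    Measurable G := by
  refine measurable_of_Ioi fun a => ?_
  -- A strict inequality between standard parts is not internal, but with a margin 1 / (n + 1) it
  -- becomes a countable union of internal sets.
  have : G ⁻¹' Set.Ioi a =
      ⋃ n : ℕ, internalSet U N fun k => {M | a + 1 / ((n : ℝ) + 1) ≤ F k M} := by
    ext Y
    simp only [Set.mem_preimage, Set.mem_Ioi, Set.mem_iUnion, mem_internalSet, Set.mem_ofPred_eq]
    constructor
    · intro hY
      obtain ⟨n, hn⟩ := exists_nat_one_div_lt (sub_pos.2 hY)
      exact ⟨n, ((h Y).eventually (lt_mem_nhds (by linarith))).mono fun _ => le_of_lt⟩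
    · rintro ⟨n, hn⟩
      have h1 := ge_of_tendsto (h Y) hn
      have h2 : 0 < 1 / ((n : ℝ) + 1) := Nat.one_div_pos_of_nat
      linarith
  rw [this]
  exact .iUnion fun n => measurableSet_internalSet _

/-- Clopen sets form a π-system generating the Borel sets, and at a clopen set the limit law is the
standard part of an internal function. -/
theorem measurable_limitMeasure :
    Measurable fun Y : HyperStateDesc U N => (limitMeasure Y : Measure (ℕ → ℕ → Bool)) := by
  refine Measurable.measure_of_isPiSystem_of_isProbabilityMeasure
    (S := {s : Set (ℕ → ℕ → Bool) | IsClopen s}) ?_ ?_ fun C hC => ?_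
  · rw [← isTopologicalBasis_isClopen.borel_eq_generateFrom]
    exact BorelSpace.measurable_eq
  · exact fun s hs t ht _ => IsClopen.inter hs ht
  · have h1 := (measurable_of_tendsto_rep (U := U) (N := N)
      (F := fun _ M => (sampleMeasure M : Measure (ℕ → ℕ → Bool)).real C)
      fun Y => tendsto_sampleMeasure Y hC).ennreal_ofReal
    simpa only [ofReal_measureReal (measure_ne_top _ _)] using h1

theorem measurable_limitMeasure_real {s : Set (ℕ → ℕ → Bool)} (hs : MeasurableSet s) :
    Measurable fun Y : HyperStateDesc U N => (limitMeasure Y : Measure (ℕ → ℕ → Bool)).real s :=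
  ((Measure.measurable_coe hs).comp measurable_limitMeasure).ennreal_toReal

theorem measurable_stNabla (hN : Tendsto N (U : Filter I) atTop) {P : Type} [Fintype P]
    [DecidableEq P] {f : P → ℕ} (hf : Function.Injective f) (θ : Sentence P) :
    Measurable fun Y : HyperStateDesc U N => stNabla U N Y θ := by
  simp only [stNabla_eq hN _ hf Function.injective_id]
  exact measurable_limitMeasure_real (measurableSet_true f id θ)

theorem isProbFun_stNabla (hN : Tendsto N (U : Filter I) atTop) {P : Type} [Fintype P]
    [DecidableEq P] {f : P → ℕ} (hf : Function.Injective f) (Y : HyperStateDesc U N) :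
    IsProbFun (stNabla U N Y : Sentence P → ℝ) := by
  have : (stNabla U N Y : Sentence P → ℝ) = _ :=
    funext fun θ => stNabla_eq hN Y hf Function.injective_id θ
  rw [this]
  exact isProbFun_of_measure _ f id

theorem stNabla_rename_pred (hN : Tendsto N (U : Filter I) atTop) {P P' : Type} [Fintype P]
    [DecidableEq P] [Fintype P'] [DecidableEq P'] {f : P → P'} (hf : Function.Injective f)
    {f' : P' → ℕ} (hf' : Function.Injective f') (Y : HyperStateDesc U N) (θ : Sentence P) :
    stNabla U N Y (θ.rename f id) = stNabla U N Y θ := by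
  rw [stNabla_eq hN Y hf' Function.injective_id,
    stNabla_eq hN Y (hf'.comp hf) Function.injective_id]
  simp only [true_rename]
  rfl

theorem stNabla_rename_const (hN : Tendsto N (U : Filter I) atTop) {P : Type} [Fintype P]
    [DecidableEq P] {f : P → ℕ} (hf : Function.Injective f) (σ : Equiv.Perm ℕ)
    (Y : HyperStateDesc U N) (θ : Sentence P) :
    stNabla U N Y (θ.rename id σ) = stNabla U N Y θ := by
  rw [stNabla_eq hN Y hf Function.injective_id, stNabla_eq hN Y hf σ.injective]
  congr 1
  ext ω
  refine (true_rename _ _ _ _).trans (Iff.symm ?_)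
  -- As a map of domains, σ carries the structure with permuted columns to the one with permuted
  -- constants.
  refine (sat_of_surjective (canon f σ ω) ((canon f id ω).reindex id σ) σ σ.surjective
    (fun _ => rfl) (fun _ _ => Iff.rfl) θ _).trans (iff_of_eq (congrArg _ ?_))
  exact Subsingleton.elim (α := Fin 0 → ℕ) _ _

end Ultrapower

/-! ### The Loeb measure of an internal probability -/

section Loeb

variable {I : Type*} {U : Ultrafilter I} {N : I → ℕ}

/-- If inclusion fails at U-almost all indices, counterexamples chosen there assemble into a point
of the difference. Hence an internal set determines its representing sets U-almost everywhere. -/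
theorem internalSet_subset_iff {S S' : (k : I) → Set (Fin (N k) → Fin (N k) → Bool)} :
    internalSet U N S ⊆ internalSet U N S' ↔ ∀ᶠ k in (U : Filter I), S k ⊆ S' k := by
  constructor
  · intro h
    by_contra hc
    rw [← Ultrafilter.eventually_not] at hc
    have hex : ∀ k, ∃ M : Fin (N k) → Fin (N k) → Bool, ¬ S k ⊆ S' k → M ∈ S k ∧ M ∉ S' k := by
      intro k
      by_cases hk : S k ⊆ S' k
      · exact ⟨fun _ _ => true, fun h => absurd hk h⟩
      · obtain ⟨M, h1, h2⟩ := Set.not_subset.1 hk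
        exact ⟨M, fun _ => ⟨h1, h2⟩⟩
    choose f hf using hex
    have h1 := h (mk_mem_internalSet (hc.mono fun k hk => (hf k hk).1))
    obtain ⟨f', hf', h2⟩ := h1
    have h3 : ∀ᶠ k in (U : Filter I), f' k = f k := Quotient.exact hf'
    obtain ⟨k, hk, h2, h3⟩ := (hc.and (h2.and h3)).exists
    exact (hf k hk).2 (h3 ▸ h2)
  · exact fun h Y hY => mem_internalSet.2 ((mem_internalSet.1 hY).mp (h.mono fun k h1 h2 => h1 h2))

theorem internalSet_compl (S : (k : I) → Set (Fin (N k) → Fin (N k) → Bool)) :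
    (internalSet U N S)ᶜ = internalSet U N fun k => (S k)ᶜ := by
  ext Y
  simp only [Set.mem_compl_iff, mem_internalSet, Ultrafilter.eventually_not]

theorem internalSet_union (S S' : (k : I) → Set (Fin (N k) → Fin (N k) → Bool)) :
    internalSet U N S ∪ internalSet U N S' = internalSet U N fun k => S k ∪ S' k := by
  ext Y
  simp only [Set.mem_union, mem_internalSet, Ultrafilter.eventually_or]

theorem internalSet_inter (S S' : (k : I) → Set (Fin (N k) → Fin (N k) → Bool)) :
    internalSet U N S ∩ internalSet U N S' = internalSet U N fun k => S k ∩ S' k := by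
  ext Y
  simp only [Set.mem_inter_iff, mem_internalSet, Filter.eventually_and]

theorem internalSet_empty : internalSet U N (fun _ => ∅) = ∅ := by
  ext Y
  simp [mem_internalSet, U.neBot.ne]

theorem internalSet_univ : internalSet U N (fun _ => Set.univ) = Set.univ := by
  ext Y
  simp [mem_internalSet]

variable (U N) in
/-- The algebra of internal sets. -/
def internalSets : Set (Set (HyperStateDesc U N)) := {A | ∃ S, A = internalSet U N S}

theorem isSetAlgebra_internalSets : IsSetAlgebra (internalSets U N) where
  empty_mem := ⟨_, internalSet_empty.symm⟩
  compl_mem := by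
    rintro _ ⟨S, rfl⟩
    exact ⟨_, internalSet_compl S⟩
  union_mem := by
    rintro _ _ ⟨S, rfl⟩ ⟨S', rfl⟩
    exact ⟨_, internalSet_union S S'⟩

/-- Countable saturation: a decreasing sequence of nonempty internal sets has a common point. -/
theorem internalSets_iInter_nonempty (hN : Tendsto N (U : Filter I) atTop)
    {A : ℕ → Set (HyperStateDesc U N)} (hA : ∀ n, A n ∈ internalSets U N) (hanti : Antitone A)
    (hne : ∀ n, (A n).Nonempty) : (⋂ n, A n).Nonempty := by
  classical
  choose S hS using hA
  let T : ℕ → (k : I) → Set (Fin (N k) → Fin (N k) → Bool) := fun n k => ⋂ i ≤ n, S i k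
  have hT : ∀ n, ∀ᶠ k in (U : Filter I), (T n k).Nonempty := by
    intro n
    obtain ⟨Y, hY⟩ := hne n
    have h : ∀ᶠ k in (U : Filter I), ∀ i ∈ Set.Iic n, Y.rep k ∈ S i k :=
      (eventually_all_finite (Set.finite_Iic n)).2 fun i hi =>
        mem_internalSet.1 (hS i ▸ hanti hi hY)
    exact h.mono fun k hk => ⟨Y.rep k, Set.mem_iInter₂.2 hk⟩
  -- Diagonal choice: at index k as many conditions as possible are met, up to the bound `N k`. As
  -- `N` tends to infinity, each fixed n is reached at U-almost all k.
  let d : I → ℕ := fun k => Nat.findGreatest (fun n => (T n k).Nonempty) (N k)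
  let f : (k : I) → Fin (N k) → Fin (N k) → Bool := fun k =>
    if h : (T (d k) k).Nonempty then h.some else fun _ _ => true
  refine ⟨Quotient.mk (productSetoid (U : Filter I) _) f, Set.mem_iInter.2 fun n => ?_⟩
  rw [hS n]
  refine mk_mem_internalSet ?_
  filter_upwards [hT n, hN.eventually_ge_atTop n] with k h1 h2
  have h3 : (T (d k) k).Nonempty := Nat.findGreatest_spec (P := fun n => (T n k).Nonempty) h2 h1
  have h4 : n ≤ d k := Nat.le_findGreatest h2 h1
  have h5 : f k ∈ T (d k) k := by
    simp only [f, dif_pos h3]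
    exact h3.some_mem
  exact Set.mem_iInter₂.1 h5 n h4

variable (P : (k : I) → Measure (Fin (N k) → Fin (N k) → Bool))

open Classical in
variable (U) in
/-- The limit of the probabilities of the representatives of an internal set. -/
noncomputable def limitContent (A : Set (HyperStateDesc U N)) : ENNReal :=
  if h : A ∈ internalSets U N then
    (exists_tendsto_of_compact U fun k => P k (h.choose k)).choose
  else 0

theorem tendsto_limitContent (S : (k : I) → Set (Fin (N k) → Fin (N k) → Bool)) :
    Tendsto (fun k => P k (S k)) U (𝓝 (limitContent U P (internalSet U N S))) := by
  have h : internalSet U N S ∈ internalSets U N := ⟨S, rfl⟩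
  rw [limitContent, dif_pos h]
  refine (exists_tendsto_of_compact U fun k => P k (h.choose k)).choose_spec.congr' ?_
  have h1 := h.choose_spec
  filter_upwards [internalSet_subset_iff.1 h1.subset, internalSet_subset_iff.1 h1.symm.subset]
    with k h2 h3
  rw [h3.antisymm h2]

/-- The internal probability measure represented by `P` extends to the generated `σ`-algebra. -/
theorem exists_loebMeasure (hN : Tendsto N (U : Filter I) atTop)
    [∀ k, IsProbabilityMeasure (P k)] :
    ∃ ρ : Measure (HyperStateDesc U N), IsProbabilityMeasure ρ ∧
      ∀ S : (k : I) → Set (Fin (N k) → Fin (N k) → Bool),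
        Tendsto (fun k => (P k).real (S k)) U (𝓝 (ρ.real (internalSet U N S))) := by
  have hring := (isSetAlgebra_internalSets (U := U) (N := N)).isSetRing
  have hle : ∀ A ∈ internalSets U N, limitContent U P A ≤ 1 := by
    rintro _ ⟨S, rfl⟩
    exact le_of_tendsto' (tendsto_limitContent P S) fun k => prob_le_one
  have hempty : limitContent U P ∅ = 0 := by
    rw [← internalSet_empty (U := U) (N := N)]
    refine tendsto_nhds_unique (tendsto_limitContent P _) ?_
    simp
  let m : AddContent ENNReal (internalSets U N) := hring.addContent_of_union (limitContent U P)
    hempty (by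
      rintro _ _ ⟨S, rfl⟩ ⟨S', rfl⟩ hd
      rw [internalSet_union]
      refine tendsto_nhds_unique (tendsto_limitContent P _)
        (((tendsto_limitContent P S).add (tendsto_limitContent P S')).congr' ?_)
      rw [Set.disjoint_iff, internalSet_inter, ← internalSet_empty (U := U) (N := N),
        internalSet_subset_iff] at hd
      filter_upwards [hd] with k hk
      exact (measure_union (Set.disjoint_iff.2 hk) .of_discrete).symm)
  have hm : ∀ A, m A = limitContent U P A := fun A => rfl
  have hsub : m.IsSigmaSubadditive := by
    -- σ-additivity reduces to continuity at ∅, which is trivial here: by saturation, a decreasing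
    -- sequence of internal sets with empty intersection is eventually empty.
    refine isSigmaSubadditive_of_addContent_iUnion_eq_tsum hring fun f hf hU hd =>
      addContent_iUnion_eq_sum_of_tendsto_zero hring m
        (fun A hA => ((hle A hA).trans_lt ENNReal.one_lt_top).ne) (fun A hA hanti hemp => ?_)
        hf hU hd
    have : ∃ n, A n = ∅ := by
      by_contra hc
      push Not at hc
      obtain ⟨Y, hY⟩ := internalSets_iInter_nonempty hN hA hanti hc
      exact Set.notMem_empty Y (hemp ▸ hY)
    obtain ⟨n, hn⟩ := this
    refine tendsto_const_nhds.congr' ?_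
    filter_upwards [eventually_ge_atTop n] with i hi
    have : A i = ∅ := Set.subset_empty_iff.1 (hn ▸ hanti hi)
    rw [this, hm, hempty]
  have hgen : instMeasurableSpaceHyperStateDesc U N =
      MeasurableSpace.generateFrom (internalSets U N) := rfl
  have hval : ∀ S, m.measure hring.isSetSemiring hgen.le hsub (internalSet U N S) =
      limitContent U P (internalSet U N S) := fun S =>
    m.measure_eq hring.isSetSemiring hgen hsub ⟨S, rfl⟩
  have hprob : IsProbabilityMeasure (m.measure hring.isSetSemiring hgen.le hsub) := ⟨by
    rw [← internalSet_univ, hval]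
    refine tendsto_nhds_unique (tendsto_limitContent P _) ?_
    simp⟩
  refine ⟨m.measure hring.isSetSemiring hgen.le hsub, hprob, fun S => ?_⟩
  have := tendsto_limitContent (U := U) P S
  rw [← hval] at this
  exact (ENNReal.tendsto_toReal (measure_ne_top _ _)).comp this

/-- Lower approximation of numbers in the unit interval by multiples of `1 / n`. -/
theorem sum_step_bounds {n : ℕ} (hn : 0 < n) {x : ℝ} (hx : x ∈ Set.Icc (0 : ℝ) 1) :
    ∑ i ∈ Finset.range n, (if ((i : ℝ) + 1) / n ≤ x then 1 / (n : ℝ) else 0) ≤ x ∧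
    x ≤ ∑ i ∈ Finset.range n, (if ((i : ℝ) + 1) / n ≤ x then 1 / (n : ℝ) else 0) + 1 / n := by
  have hn' : (0 : ℝ) < n := Nat.cast_pos.2 hn
  have hfl : ⌊x * n⌋₊ ≤ n := by
    exact Nat.floor_le_of_le (mul_le_of_le_one_left hn'.le hx.2)
  -- The sum is therefore ⌊x n⌋ / n.
  have hfilter : (Finset.range n).filter (fun i : ℕ => ((i : ℝ) + 1) / n ≤ x) =
      Finset.range ⌊x * n⌋₊ := by
    ext i
    rw [Finset.mem_filter, Finset.mem_range, Finset.mem_range, div_le_iff₀ hn',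
      ← Nat.succ_le_iff (m := i) (n := ⌊x * n⌋₊), Nat.le_floor_iff (mul_nonneg hx.1 hn'.le)]
    push_cast
    constructor
    · exact fun h => h.2
    · intro h
      refine ⟨?_, h⟩
      have : i + 1 ≤ ⌊x * n⌋₊ := Nat.le_floor (by push_cast; exact h)
      omega
  rw [← Finset.sum_filter, hfilter, Finset.sum_const, Finset.card_range, nsmul_eq_mul,
    ← mul_div_assoc, mul_one, ← add_div, div_le_iff₀ hn', le_div_iff₀ hn']
  exact ⟨Nat.floor_le (mul_nonneg hx.1 hn'.le), (Nat.lt_floor_add_one _).le⟩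

/-- Integrals of bounded internal functions: the standard part of the internal expectation is the
integral of the standard part. -/
theorem tendsto_integral_loebMeasure [∀ k, IsProbabilityMeasure (P k)]
    {ρ : Measure (HyperStateDesc U N)} [IsProbabilityMeasure ρ]
    (hρ : ∀ S : (k : I) → Set (Fin (N k) → Fin (N k) → Bool),
      Tendsto (fun k => (P k).real (S k)) U (𝓝 (ρ.real (internalSet U N S))))
    {F : (k : I) → (Fin (N k) → Fin (N k) → Bool) → ℝ} (hF : ∀ k M, F k M ∈ Set.Icc (0 : ℝ) 1)
    {G : HyperStateDesc U N → ℝ}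
    (hG : ∀ Y : HyperStateDesc U N, Tendsto (fun k => F k (Y.rep k)) U (𝓝 (G Y))) :
    Tendsto (fun k => ∫ M, F k M ∂(P k)) U (𝓝 (∫ Y, G Y ∂ρ)) := by
  classical
  have hG01 : ∀ Y, G Y ∈ Set.Icc (0 : ℝ) 1 := fun Y =>
    isClosed_Icc.mem_of_tendsto (hG Y) (Eventually.of_forall fun k => hF k _)
  have hGint : Integrable G ρ :=
    .of_mem_Icc 0 1 (measurable_of_tendsto_rep hG).aemeasurable (Eventually.of_forall hG01)
  rw [Metric.tendsto_nhds]
  intro ε hε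
  obtain ⟨n', hn'⟩ := exists_nat_one_div_lt (show 0 < ε / 3 by linarith)
  obtain ⟨n, hn, hnε⟩ : ∃ n : ℕ, 0 < n ∧ 1 / (n : ℝ) < ε / 3 :=
    ⟨n' + 1, n'.succ_pos, by push_cast; exact hn'⟩
  -- Level sets of F give step functions s below F and T below G, each within 1 / n. Their integrals
  -- are finite sums of measures of (internal) level sets, to which `hρ` applies.
  let S : ℕ → (k : I) → Set (Fin (N k) → Fin (N k) → Bool) :=
    fun i k => {M | ((i : ℝ) + 1) / n ≤ F k M}
  let s : (k : I) → (Fin (N k) → Fin (N k) → Bool) → ℝ := fun k M =>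
    ∑ i ∈ Finset.range n, (S i k).indicator (fun _ => 1 / (n : ℝ)) M
  let T : HyperStateDesc U N → ℝ := fun Y =>
    ∑ i ∈ Finset.range n, (internalSet U N (S i)).indicator (fun _ => 1 / (n : ℝ)) Y
  have hs : ∀ k M, s k M ≤ F k M ∧ F k M ≤ s k M + 1 / n := fun k M => sum_step_bounds hn (hF k M)
  have hsT : ∀ Y : HyperStateDesc U N, Tendsto (fun k => s k (Y.rep k)) U (𝓝 (T Y)) := by
    intro Y
    refine tendsto_finsetSum _ fun i _ => tendsto_const_nhds.congr' ?_
    by_cases hY : Y ∈ internalSet U N (S i)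
    · filter_upwards [mem_internalSet.1 hY] with k hk
      rw [Set.indicator_of_mem hY, Set.indicator_of_mem hk]
    · rw [← Set.mem_compl_iff, internalSet_compl] at hY
      filter_upwards [mem_internalSet.1 hY] with k hk
      rw [← internalSet_compl] at hY
      rw [Set.indicator_of_notMem hY, Set.indicator_of_notMem hk]
  have hT1 : ∀ Y, T Y ≤ G Y := fun Y =>
    le_of_tendsto_of_tendsto' (hsT Y) (hG Y) fun k => (hs k _).1
  have hT2 : ∀ Y, G Y ≤ T Y + 1 / n := fun Y =>
    le_of_tendsto_of_tendsto' (hG Y) ((hsT Y).add_const _) fun k => (hs k _).2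
  have hind : ∀ i, Integrable ((internalSet U N (S i)).indicator fun _ => 1 / (n : ℝ)) ρ := fun i =>
    (integrable_const _).indicator (measurableSet_internalSet _)
  have hTint : Integrable T ρ := integrable_finsetSum _ fun i _ => hind i
  have hsint : ∀ k, ∫ M, s k M ∂(P k) = ∑ i ∈ Finset.range n, (P k).real (S i k) * (1 / n) := by
    intro k
    rw [integral_finsetSum _ fun i _ => .of_finite]
    refine Finset.sum_congr rfl fun i _ => ?_
    rw [integral_indicator_const _ .of_discrete, smul_eq_mul]
  have hTval : ∫ Y, T Y ∂ρ = ∑ i ∈ Finset.range n, ρ.real (internalSet U N (S i)) * (1 / n) := by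
    rw [integral_finsetSum _ fun i _ => hind i]
    refine Finset.sum_congr rfl fun i _ => ?_
    rw [integral_indicator_const _ (measurableSet_internalSet _), smul_eq_mul]
  have hlim : Tendsto (fun k => ∫ M, s k M ∂(P k)) U (𝓝 (∫ Y, T Y ∂ρ)) := by
    simp only [hsint, hTval]
    exact tendsto_finsetSum _ fun i _ => (hρ (S i)).mul_const _
  have hTG1 : ∫ Y, T Y ∂ρ ≤ ∫ Y, G Y ∂ρ := integral_mono hTint hGint hT1
  have hTG2 : ∫ Y, G Y ∂ρ ≤ ∫ Y, T Y ∂ρ + 1 / n := by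
    have := integral_mono hGint (hTint.add (integrable_const (1 / (n : ℝ)))) hT2
    simpa only [Pi.add_apply, integral_add hTint (integrable_const _), integral_const, probReal_univ,
      one_smul] using this
  filter_upwards [Metric.tendsto_nhds.1 hlim (ε / 3) (by linarith)] with k hk
  have hF1 : ∫ M, s k M ∂(P k) ≤ ∫ M, F k M ∂(P k) :=
    integral_mono .of_finite .of_finite fun M => (hs k M).1
  have hF2 : ∫ M, F k M ∂(P k) ≤ ∫ M, s k M ∂(P k) + 1 / n := by
    have := integral_mono (μ := P k) .of_finite
      (Integrable.add .of_finite (integrable_const (1 / (n : ℝ)))) fun M => (hs k M).2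
    simpa only [Pi.add_apply, integral_add (.of_finite : Integrable (s k) (P k))
      (integrable_const _), integral_const, probReal_univ, one_smul] using this
  rw [Real.dist_eq, abs_lt] at hk ⊢
  constructor <;> linarith [hk.1, hk.2]

end Loeb

/-! ### Mixtures of the functions `°∇` -/

section Mixture

variable {I : Type*} {U : Ultrafilter I} {N : I → ℕ}

theorem integrable_stNabla (hN : Tendsto N (U : Filter I) atTop) {P : Type} [Fintype P]
    [DecidableEq P] {f : P → ℕ} (hf : Function.Injective f) (ρ : Measure (HyperStateDesc U N))
    [IsProbabilityMeasure ρ] (θ : Sentence P) : Integrable (fun Y => stNabla U N Y θ) ρ :=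
  .of_mem_Icc 0 1 (measurable_stNabla hN hf θ).aemeasurable
    (Eventually.of_forall fun Y => (isProbFun_stNabla hN hf Y).mem_Icc θ)

theorem isProbFun_integral_stNabla (hN : Tendsto N (U : Filter I) atTop) {P : Type} [Fintype P]
    [DecidableEq P] {f : P → ℕ} (hf : Function.Injective f) (ρ : Measure (HyperStateDesc U N))
    [IsProbabilityMeasure ρ] :
    IsProbFun fun θ : Sentence P => ∫ Y, stNabla U N Y θ ∂ρ where
  mem_Icc θ := by
    constructor
    · exact integral_nonneg fun Y => (isProbFun_stNabla hN hf Y).nonneg θ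
    · have := integral_mono (integrable_stNabla hN hf ρ θ) (integrable_const (1 : ℝ))
        fun Y => (isProbFun_stNabla hN hf Y).le_one θ
      simpa using this
  valid θ h := by
    simp [fun Y => (isProbFun_stNabla hN hf Y : IsProbFun (stNabla U N Y)).valid θ h]
  add θ φ h := by
    simp only [fun Y => (isProbFun_stNabla hN hf Y : IsProbFun (stNabla U N Y)).add θ φ h]
    exact integral_add (integrable_stNabla hN hf ρ θ) (integrable_stNabla hN hf ρ φ)
  exists_lim ψ := by
    refine tendsto_integral_of_dominated_convergence (fun _ => 1)
      (fun n => (measurable_stNabla hN hf _).aestronglyMeasurable) (integrable_const _)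
      (fun n => Eventually.of_forall fun Y => ?_)
      (Eventually.of_forall fun Y => (isProbFun_stNabla hN hf Y).exists_lim ψ)
    rw [Real.norm_of_nonneg ((isProbFun_stNabla hN hf Y).nonneg _)]
    exact (isProbFun_stNabla hN hf Y).le_one _

/-- The same ρ serves in every language, and the required invariances hold for each Υ under the
integral sign. -/
theorem uli_integral_stNabla (hN : Tendsto N (U : Filter I) atTop)
    (ρ : Measure (HyperStateDesc U N)) [IsProbabilityMeasure ρ] (L : Finset ℕ) :
    ULi L fun θ => ∫ Y, stNabla U N Y θ ∂ρ := by
  have hval : ∀ K : Finset ℕ, Function.Injective (Subtype.val : K → ℕ) :=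
    fun K => Subtype.val_injective
  refine ⟨fun K θ => ∫ Y, stNabla U N Y θ ∂ρ, fun K =>
    ⟨isProbFun_integral_stNabla hN (hval K) ρ, fun σ φ => ?_, fun σ φ => ?_⟩, rfl,
    fun K' K h θ => ?_⟩
  · simp only [stNabla_rename_const hN (hval K)]
  · simp only [stNabla_rename_pred hN σ.injective (hval K)]
  · simp only [stNabla_rename_pred hN (Set.inclusion_injective h) (hval K)]

end Mixture

/-! ### The matrices described by a language invariant family -/

/-- The distribution of the state descriptions for the first `n` constants. -/
theorem IsProbFun.exists_measure {P : Type} [Fintype P] {w : Sentence P → ℝ} (hw : IsProbFun w)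
    (n : ℕ) : ∃ Q : Measure (Fin n → P → Bool), IsProbabilityMeasure Q ∧
      ∀ χ : Sentence P, Finitary n χ → Q.real {h | (extModel h).True χ} = w χ := by
  classical
  let Q : Measure (Fin n → P → Bool) :=
    ∑ h : Fin n → P → Bool, ENNReal.ofReal (w (stateDesc h Fin.val)) • Measure.dirac h
  have hQ : ∀ χ : Sentence P, Finitary n χ →
      Q {h | (extModel h).True χ} = ENNReal.ofReal (w χ) := by
    intro χ hχ
    rw [hw.finitary_eq_sum hχ, ENNReal.ofReal_sum_of_nonneg]
    · simp only [Q, Measure.finsetSum_apply, Measure.smul_apply]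
      refine Finset.sum_congr rfl fun h _ => ?_
      rw [Measure.dirac_apply' _ .of_discrete]
      by_cases hh : (extModel h).True χ <;> simp [hh]
    · intro h _
      split_ifs
      exacts [hw.nonneg _, le_rfl]
  have htop : Valid (Fml.top : Sentence P) := fun M => True.intro
  have huniv : {h : Fin n → P → Bool | (extModel h).True Fml.top} = Set.univ :=
    Set.eq_univ_of_forall fun h => True.intro
  refine ⟨Q, ⟨?_⟩, fun χ hχ => ?_⟩
  · rw [← huniv, hQ _ fun M M' _ => Iff.rfl, hw.valid _ htop, ENNReal.ofReal_one]
  · rw [measureReal_def, hQ χ hχ, ENNReal.toReal_ofReal (hw.nonneg _)]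

/-- In a language invariant family, the value of a state description depends on the signs only. -/
theorem rename_stateDesc_eq {W : (K : Finset ℕ) → Sentence K → ℝ}
    (hW : ∀ K, IsProbFun (W K) ∧ Ex (W K) ∧ Px (W K))
    (hcomp : ∀ (K' K : Finset ℕ) (h : K' ⊆ K) (θ : Sentence K'),
      W K' θ = W K (θ.rename (Set.inclusion h) id))
    {K' K : Finset ℕ} (h : K' ⊆ K) {e : K' → K} (he : Function.Injective e) {n : ℕ}
    {i : Fin n → ℕ} (hi : Function.Injective i) (d : Fin n → K' → Bool) :
    W K ((stateDesc d i).rename e id) = W K' (stateDesc d Fin.val) := by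
  -- Some permutation of the predicates of K carries the inclusion to e, and one of the constants
  -- carries the first n to i; Px and Ex then apply.
  obtain ⟨σ, hσ⟩ := Equiv.Perm.exists_extending_pair (Set.inclusion h) e
    (Set.inclusion_injective h) he
  obtain ⟨τ, hτ⟩ := Equiv.Perm.exists_extending_pair (Fin.val : Fin n → ℕ) i Fin.val_injective hi
  rw [hcomp K' K h, ← (hW K).2.2 σ (Fml.rename (Set.inclusion h) id _),
    ← (hW K).2.1 τ (Fml.rename σ id _)]
  refine (hW K).1.congr fun M => ?_
  simp only [true_rename, true_stateDesc]
  refine forall_congr' fun j => forall_congr' fun p => ?_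
  change (M.pred (e p) (M.const (i j)) ↔ _) ↔
    (M.pred (σ (Set.inclusion h p)) (M.const (τ j)) ↔ _)
  rw [hσ, hτ]

/-- The random `m × m` matrix given by a language invariant family. -/
theorem exists_matrix_measure {W : (K : Finset ℕ) → Sentence K → ℝ}
    (hW : ∀ K, IsProbFun (W K) ∧ Ex (W K) ∧ Px (W K))
    (hcomp : ∀ (K' K : Finset ℕ) (h : K' ⊆ K) (θ : Sentence K'),
      W K' θ = W K (θ.rename (Set.inclusion h) id)) (m : ℕ) :
    ∃ R : Measure (Fin m → Fin m → Bool), IsProbabilityMeasure R ∧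
      ∀ q ≤ m, ∀ (n : ℕ) (d : Fin n → Lang q → Bool) (e : Lang q → Fin m) (c : Fin n → Fin m),
        Function.Injective e → Function.Injective c →
        R.real {M | ∀ j p, M (e p) (c j) = d j p} = W (Lang q) (stateDesc d Fin.val) := by
  obtain ⟨Q, hQ, hQval⟩ := (hW (Lang m)).1.exists_measure m
  let ι : Fin m → Lang m := fun a => ⟨a, Finset.mem_range.2 a.2⟩
  have hι : Function.Injective ι := fun a b h => Fin.ext (congrArg Subtype.val h)
  -- State descriptions list signs constant by constant, while rows of a matrix are predicates:
  -- hence the transposition.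
  let T : (Fin m → Lang m → Bool) → Fin m → Fin m → Bool := fun h a j => h j (ι a)
  have hT : Measurable T := .of_discrete
  refine ⟨Q.map T, Measure.isProbabilityMeasure_map hT.aemeasurable,
    fun q hq n d e c he hc => ?_⟩
  rw [map_measureReal_apply hT .of_discrete,
    ← rename_stateDesc_eq hW hcomp (Finset.range_mono hq) (hι.comp he)
      (Fin.val_injective.comp hc) d, ← hQval]
  · congr 1
    ext h
    simp only [Set.mem_preimage, Set.mem_ofPred_eq, true_rename, true_stateDesc]
    refine forall_congr' fun j => forall_congr' fun p => ?_
    change (h (c j) (ι (e p)) = d j p) ↔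
      ((∃ hd : (c j : ℕ) < m, h ⟨c j, hd⟩ (ι (e p)) = true) ↔ d j p = true)
    simp only [Fin.is_lt, exists_true_left, Fin.eta]
    exact Bool.eq_iff_iff
  · intro M M' hM
    simp only [true_rename, true_stateDesc]
    exact forall_congr' fun j => forall_congr' fun p =>
      iff_congr (hM (ι (e p)) (c j) (c j).2) Iff.rfl

/-! ### Sampling with and without replacement -/

open Classical in
/-- The probability that a random function `J → Fin m` is injective. -/
noncomputable def injRatio (J : Type) [Fintype J] [DecidableEq J] (m : ℕ) : ℝ :=
  ∑ e : J → Fin m, 1 / (m : ℝ) ^ Fintype.card J * if Function.Injective e then 1 else 0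

/-- The number of injections is the falling factorial of m, asymptotic to the power of m that counts
all functions. -/
theorem tendsto_injRatio (J : Type) [Fintype J] [DecidableEq J] : Tendsto (injRatio J) atTop (𝓝 1) := by
  classical
  have h1 : ∀ m, injRatio J m =
      (m.descFactorial (Fintype.card J) : ℝ) / (m : ℝ) ^ Fintype.card J := by
    intro m
    have h2 : (Finset.univ.filter fun e : J → Fin m => Function.Injective e).card =
        m.descFactorial (Fintype.card J) := by
      rw [← Fintype.card_subtype,
        Fintype.card_congr (Equiv.subtypeInjectiveEquivEmbedding J (Fin m)),
        Fintype.card_embedding_eq, Fintype.card_fin]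
    rw [injRatio, ← Finset.mul_sum, Finset.sum_boole, h2, one_div, div_eq_inv_mul]
  have h3 := isEquivalent_descFactorial (Fintype.card J)
  rw [Asymptotics.isEquivalent_iff_tendsto_one
    ((eventually_ge_atTop 1).mono fun m hm => by positivity)] at h3
  exact h3.congr fun m => (h1 m).symm

theorem sum_uniform {J : Type} [Fintype J] [DecidableEq J] {m : ℕ} (hm : 0 < m) :
    ∑ _e : J → Fin m, 1 / (m : ℝ) ^ Fintype.card J = 1 := by
  have : (m : ℝ) ≠ 0 := Nat.cast_ne_zero.2 hm.ne'
  rw [Finset.sum_const, Finset.card_univ, Fintype.card_fun, Fintype.card_fin, nsmul_eq_mul]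
  push_cast
  field_simp

/-- The expectation of `nablaFin` at a random matrix for which the frequency of a pattern in
distinct rows and columns is `r`. -/
theorem abs_integral_nablaFin_sub_le {P : Type} [Fintype P] [DecidableEq P] {m : ℕ} (hm : 0 < m)
    (R : Measure (Fin m → Fin m → Bool)) [IsProbabilityMeasure R] {n : ℕ} (d : Fin n → P → Bool)
    {r : ℝ} (hr : r ∈ Set.Icc (0 : ℝ) 1)
    (hR : ∀ (e : P → Fin m) (c : Fin n → Fin m), Function.Injective e → Function.Injective c →
      R.real {M | ∀ j p, M (e p) (c j) = d j p} = r) :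
    |∫ M, nablaFin M d ∂(R) - r| ≤ 1 - injRatio P m * injRatio (Fin n) m := by
  classical
  let a : ℝ := 1 / (m : ℝ) ^ Fintype.card P
  let b : ℝ := 1 / (m : ℝ) ^ n
  have ha : 0 ≤ a := by positivity
  have hb : 0 ≤ b := by positivity
  have hasum : ∑ _e : P → Fin m, a = 1 := sum_uniform hm
  have hbsum : ∑ _c : Fin n → Fin m, b = 1 := by
    have := sum_uniform (J := Fin n) hm
    rwa [Fintype.card_fin] at this
  have hconst : ∀ x : ℝ, ∑ _e : P → Fin m, ∑ _c : Fin n → Fin m, a * (b * x) = x := by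
    intro x
    have := Finset.sum_mul_sum (Finset.univ : Finset (P → Fin m))
      (Finset.univ : Finset (Fin n → Fin m)) (fun _ => a) fun _ => b * x
    rw [← this, hasum, ← Finset.sum_mul, hbsum, one_mul, one_mul]
  have h1 : ∫ M, nablaFin M d ∂(R) = ∑ e : P → Fin m, ∑ c : Fin n → Fin m,
      a * (b * R.real {M | ∀ j p, M (e p) (c j) = d j p}) := by
    simp only [nablaFin_eq_sum]
    rw [integral_finsetSum _ fun e _ => .of_finite]
    refine Finset.sum_congr rfl fun e _ => ?_
    rw [integral_finsetSum _ fun e _ => .of_finite]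
    refine Finset.sum_congr rfl fun c _ => ?_
    rw [integral_const_mul, integral_const_mul]
    congr 2
    have := integral_indicator_const (μ := R) (1 : ℝ)
      (s := {M : Fin m → Fin m → Bool | ∀ j p, M (e p) (c j) = d j p}) .of_discrete
    simpa [Set.indicator_apply] using this
  have h2 : injRatio P m * injRatio (Fin n) m = ∑ e : P → Fin m, ∑ c : Fin n → Fin m,
      a * (b * ((if Function.Injective e then 1 else 0) *
        if Function.Injective c then 1 else 0)) := by
    rw [injRatio, injRatio, Finset.sum_mul_sum, Fintype.card_fin]
    refine Finset.sum_congr rfl fun e _ => Finset.sum_congr rfl fun c _ => ?_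
    ring
  rw [h2, h1]
  -- Writing r and 1 as means over all pairs (e, c) allows a termwise estimate: injective pairs
  -- contribute 0 to the error, all others at most 1.
  conv_lhs => rw [← hconst r]
  conv_rhs => lhs; rw [← hconst 1]
  simp only [← Finset.sum_sub_distrib, ← mul_sub]
  refine (Finset.abs_sum_le_sum_abs _ _).trans (Finset.sum_le_sum fun e _ => ?_)
  refine (Finset.abs_sum_le_sum_abs _ _).trans (Finset.sum_le_sum fun c _ => ?_)
  rw [abs_mul, abs_mul, abs_of_nonneg ha, abs_of_nonneg hb]
  refine mul_le_mul_of_nonneg_left (mul_le_mul_of_nonneg_left ?_ hb) ha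
  by_cases hinj : Function.Injective e ∧ Function.Injective c
  · rw [hR e c hinj.1 hinj.2, sub_self, abs_zero, if_pos hinj.1, if_pos hinj.2]
    norm_num
  · have h3 : ((if Function.Injective e then 1 else 0) *
        if Function.Injective c then 1 else 0 : ℝ) = 0 := by
      rcases not_and_or.1 hinj with h | h <;> simp [h]
    rw [h3, abs_le]
    have h4 : R.real {M | ∀ j p, M (e p) (c j) = d j p} ≤ 1 := measureReal_le_one
    have h5 : 0 ≤ R.real {M | ∀ j p, M (e p) (c j) = d j p} := measureReal_nonneg
    constructor <;> linarith [hr.1, hr.2]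

/-- Here ρ is the Loeb measure of the random `N k` × `N k` matrices of the family; it suffices to
compare both sides at state descriptions. -/
theorem exists_measure_of_uli {I : Type*} {U : Ultrafilter I} {N : I → ℕ}
    (hN : Tendsto N (U : Filter I) atTop) {q : ℕ} {w : Sentence (Lang q) → ℝ}
    (hw : ULi (Lang q) w) :
    ∃ ρ : Measure (HyperStateDesc U N), IsProbabilityMeasure ρ ∧
      ∀ θ, w θ = ∫ Y, stNabla U N Y θ ∂ρ := by
  obtain ⟨W, hW, rfl, hcomp⟩ := hw
  choose R hR hRval using exists_matrix_measure hW hcomp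
  obtain ⟨ρ, hρ, hρval⟩ := exists_loebMeasure (fun k => R (N k)) hN
  refine ⟨ρ, hρ, congrFun ?_⟩
  have hval : Function.Injective (Subtype.val : Lang q → ℕ) := Subtype.val_injective
  refine (hW _).1.ext_stateDesc (isProbFun_integral_stNabla hN hval ρ) fun n d => ?_
  have h1 := tendsto_integral_loebMeasure (fun k => R (N k)) hρval
    (F := fun k M => (sampleMeasure M : Measure (ℕ → ℕ → Bool)).real
      (pattern Subtype.val (Fin.val : Fin n → ℕ) d))
    (fun k M => ⟨measureReal_nonneg, measureReal_le_one⟩)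
    (fun Y => tendsto_sampleMeasure Y (isClopen_pattern _ _ _))
  have h2 : ∀ Y : HyperStateDesc U N, stNabla U N Y (stateDesc d Fin.val) =
      (limitMeasure Y : Measure (ℕ → ℕ → Bool)).real
        (pattern Subtype.val (Fin.val : Fin n → ℕ) d) := by
    intro Y
    rw [stNabla_eq hN Y hval Function.injective_id]
    simp only [true_canon_stateDesc]
    rfl
  simp only [h2]
  -- The expectations of ∇ tend to the mixture by `h1`; they tend to the value of `W` because
  -- repeated draws become negligible.
  refine tendsto_nhds_unique ?_ h1
  have h3 : Tendsto (fun m => 1 - injRatio (Lang q) m * injRatio (Fin n) m) atTop (𝓝 0) := by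
    simpa using ((tendsto_injRatio (Lang q)).mul (tendsto_injRatio (Fin n))).const_sub 1
  refine tendsto_iff_norm_sub_tendsto_zero.2
    (squeeze_zero' (Eventually.of_forall fun k => norm_nonneg _) ?_ (h3.comp hN))
  -- The matrix needs at least q rows for the predicates; the extra 1 keeps `N k` positive when q =
  -- 0.
  filter_upwards [hN.eventually_ge_atTop (q + 1)] with k hk
  have hpos : 0 < N k := by omega
  have h4 : ∀ M : Fin (N k) → Fin (N k) → Bool,
      (sampleMeasure M : Measure (ℕ → ℕ → Bool)).real
        (pattern Subtype.val (Fin.val : Fin n → ℕ) d) = nablaFin M d :=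
    fun M => sampleMeasure_pattern hpos M hval Fin.val_injective d
  simp only [h4]
  exact abs_integral_nablaFin_sub_le hpos (R (N k)) d ((hW _).1.mem_Icc _)
    fun e c he hc => hRval (N k) q (by omega) n d e c he hc

end UnaryIL

theorem theorem4p2 {I : Type*} (U : Ultrafilter I) (N : I → ℕ)
    (hN : Filter.Tendsto N (U : Filter I) Filter.atTop) (q : ℕ) :
    (∀ Y : UnaryIL.HyperStateDesc U N,
      ∃! v : UnaryIL.Sentence (UnaryIL.Lang q) → ℝ, UnaryIL.ExtendsStNabla U N Y v) ∧
    ∀ w : UnaryIL.Sentence (UnaryIL.Lang q) → ℝ, UnaryIL.IsProbFun w →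
      (UnaryIL.ULi (UnaryIL.Lang q) w ↔
        ∃ ρ : MeasureTheory.Measure (UnaryIL.HyperStateDesc U N),
          MeasureTheory.IsProbabilityMeasure ρ ∧
          ∀ θ : UnaryIL.Sentence (UnaryIL.Lang q),
            MeasureTheory.Integrable (fun Y => UnaryIL.stNabla U N Y θ) ρ ∧
            w θ = ∫ Y, UnaryIL.stNabla U N Y θ ∂ρ) := by
  have hval : Function.Injective (Subtype.val : UnaryIL.Lang q → ℕ) := Subtype.val_injective
  refine ⟨fun Y => UnaryIL.existsUnique_extendsStNabla hN Y hval, fun w _ => ⟨fun hw => ?_, ?_⟩⟩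
  · obtain ⟨ρ, hρ, h⟩ := UnaryIL.exists_measure_of_uli hN hw
    exact ⟨ρ, hρ, fun θ => ⟨UnaryIL.integrable_stNabla hN hval ρ θ, h θ⟩⟩
  · rintro ⟨ρ, hρ, h⟩
    rw [funext fun θ => (h θ).2]
    exact UnaryIL.uli_integral_stNabla hN ρ _
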